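/- **Conventions.** For a group $G$ and a generating set $S\subseteq G$ (possibly infinite), $\Gamma(G,S)$ is the Cayley graph with vertex set $G$ and edges $\{g,gs\}$, $s\in S$; its path metric on $G$ is the word metric of $S$. Finitely generated groups carry the word metric of a chosen finite generating set. A map $q\colon X\to Y$ of metric spaces is an $(L,C)$-quasi-isometry ($L\ge 1$, $C\ge 0$) if $\frac1L d(x,x')-C\le d(q(x),q(x'))\le L\,d(x,x')+C$ for all $x,x'\in X$ and every point of $Y$ is within $C$ of $q(X)$. For a collection $\mathcal P$ of subgroups of $G$, $G/\mathcal P$ denotes the set of all left cosets $gP$ with $g\in G$, $P\in\mathcal P$. An $(L,C)$-quasi-isometry $q\colon G\to H$ of finitely generated groups is an *$(L,C,M)$-quasi-isometry of pairs* $q\colon(G,\mathcal P)\to(H,\mathcal Q)$ if for every $A\in G/\mathcal P$ there is $B\in H/\mathcal Q$, and for every $B\in H/\mathcal Q$ there is $A\in G/\mathcal P$, with $\mathrm{Hdist}_H(q(A),B)<M$, where $\mathrm{Hdist}_H$ is the Hausdorff distance. It is a *quasi-isometry of pairs* if this holds for some $L,C$ and some $M>0$. A collection $\mathcal Q$ of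 subgroups of a finitely generated group $H$ is *qi-characteristic* if $\mathcal Q$ is finite, each $Q\in\mathcal Q$ has finite index in its commensurator $\{h\in H: Q\cap hQh^{-1}\text{ has finite index in }Q\text{ and in }hQh^{-1}\}$, and for all $L\ge1$, $C\ge0$ there is $M\ge 0$ such that every $(L,C)$-quasi-isometry $H\to H$ is an $(L,C,M)$-quasi-isometry of pairs $(H,\mathcal Q)\to(H,\mathcal Q)$. A collection $\mathcal P$ of subgroups of $G$ is *hyperbolically embedded* with respect to $X\subseteq G$, written $\mathcal P\hookrightarrow_h(G,X)$, if $X\cup\bigcup\mathcal P$ generates $G$, the Cayley graph $\Gamma\bigl(G,X\sqcup\bigsqcup_{P\in\mathcal P}P\bigr)$ (with edges labelled by the disjoint union) is Gromov hyperbolic, and for each $P\in\mathcal P$ the metric $\hat d_P\colon P\times P\to[0,\infty]$ is locally finite (all its balls of finite radius are finite); here $\hat d_P(g,h)$ is the length of a shortest path from $g$ to $h$ in this graph that uses no edge labelled by an element of $P$ and joining two elements of $P$. **Corollary B.** Let $G$ and $H$ be finitely generated groups, let $T$ be a (possibly infinite) generating set of $H$, let $\mathcal Q$ be a finite collection of subgroups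 of $H$ with $\mathcal Q\hookrightarrow_h(H,T)$, and let $q\colon G\to H$ be a quasi-isometry. Suppose that $\mathcal Q$ is qi-characteristic in $H$, and let $S$ be a (possibly infinite) generating set of $G$ such that $q\colon\Gamma(G,S)\to\Gamma(H,T)$ is a quasi-isometry. Then there is a finite collection $\mathcal P$ of subgroups of $G$ such that $\mathcal P\hookrightarrow_h(G,S)$ and $q\colon(G,\mathcal P)\to(H,\mathcal Q)$ is a quasi-isometry of pairs. -/

import Mathlib

open scoped Pointwise

/-!
Conventions: the vertex set of a connected graph carries the path metric `SimpleGraph.dist`. The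
Cayley graph `Γ(G, S)` is Mathlib's `SimpleGraph.mulCayley S` (edges `{g, g * s}`, `s ∈ S`); when
`S` generates `G` it is connected, and its path metric is the word metric of `(G, S)`.
-/

/-- `q : Γ → Δ` is an `(L, C)`-quasi-isometry for the path metrics. -/
def IsQuasiIsometryWith {V W : Type*} (Γ : SimpleGraph V) (Δ : SimpleGraph W) (L C : ℝ)
    (q : V → W) : Prop :=
  1 ≤ L ∧ 0 ≤ C ∧
    (∀ x y : V, (Γ.dist x y : ℝ) / L - C ≤ Δ.dist (q x) (q y) ∧
      (Δ.dist (q x) (q y) : ℝ) ≤ L * Γ.dist x y + C) ∧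
    ∀ w : W, ∃ v : V, (Δ.dist (q v) w : ℝ) ≤ C

/-- `q : Γ → Δ` is a quasi-isometry for the path metrics. -/
def IsQuasiIsometry {V W : Type*} (Γ : SimpleGraph V) (Δ : SimpleGraph W) (q : V → W) : Prop :=
  ∃ L C : ℝ, IsQuasiIsometryWith Γ Δ L C q

/-- The Hausdorff distance between the (nonempty) sets `A` and `B` is less than `M`. The Hausdorff
distance is the infimum of all `r` such that `A` lies in the closed `r`-neighbourhood of `B` and
`B` in that of `A`. -/
def HausdorffDistLT {V : Type*} (Γ : SimpleGraph V) (A B : Set V) (M : ℝ) : Prop :=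
  ∃ r : ℝ, r < M ∧ (∀ a ∈ A, ∃ b ∈ B, (Γ.dist a b : ℝ) ≤ r) ∧
    ∀ b ∈ B, ∃ a ∈ A, (Γ.dist a b : ℝ) ≤ r

/-- `q : (Γ, 𝒜) → (Δ, ℬ)` is an `(L, C, M)`-quasi-isometry of pairs. -/
def IsPairQuasiIsometryWith {V W : Type*} (Γ : SimpleGraph V) (Δ : SimpleGraph W)
    (𝒜 : Set (Set V)) (ℬ : Set (Set W)) (L C M : ℝ) (q : V → W) : Prop :=
  IsQuasiIsometryWith Γ Δ L C q ∧
    (∀ A ∈ 𝒜, ∃ B ∈ ℬ, HausdorffDistLT Δ (q '' A) B M) ∧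
    ∀ B ∈ ℬ, ∃ A ∈ 𝒜, HausdorffDistLT Δ (q '' A) B M

/-- The set `G / Ps` of all left cosets `g P` with `g ∈ G` and `P ∈ Ps`. -/
def cosetsOf {G : Type*} [Group G] (Ps : Set (Subgroup G)) : Set (Set G) :=
  {A | ∃ g : G, ∃ P ∈ Ps, A = g • (P : Set G)}

/-- `q : (G, Ps) → (H, Qs)` is an `(L, C, M)`-quasi-isometry of group pairs, for the word metrics
of the finite generating sets `S₀` of `G` and `T₀` of `H`. -/
def IsGroupPairQuasiIsometryWith {G H : Type*} [Group G] [Group H] (S₀ : Set G) (T₀ : Set H)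
    (Ps : Set (Subgroup G)) (Qs : Set (Subgroup H)) (L C M : ℝ) (q : G → H) : Prop :=
  IsPairQuasiIsometryWith (SimpleGraph.mulCayley S₀) (SimpleGraph.mulCayley T₀)
    (cosetsOf Ps) (cosetsOf Qs) L C M q

/-- `q : (G, Ps) → (H, Qs)` is a quasi-isometry of group pairs. -/
def IsGroupPairQuasiIsometry {G H : Type*} [Group G] [Group H] (S₀ : Set G) (T₀ : Set H)
    (Ps : Set (Subgroup G)) (Qs : Set (Subgroup H)) (q : G → H) : Prop :=
  ∃ L C M : ℝ, 0 < M ∧ IsGroupPairQuasiIsometryWith S₀ T₀ Ps Qs L C M q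

/-- The collection `Qs` is qi-characteristic in the group `H`, taken with the word metric of the
finite generating set `T₀`. -/
def IsQICharacteristic {H : Type*} [Group H] (T₀ : Set H) (Qs : Set (Subgroup H)) : Prop :=
  Qs.Finite ∧
    (∀ Q ∈ Qs, Q.IsFiniteRelIndex (Subgroup.Commensurable.commensurator Q)) ∧
    ∀ L C : ℝ, 1 ≤ L → 0 ≤ C → ∃ M : ℝ, 0 ≤ M ∧ ∀ f : H → H,
      IsQuasiIsometryWith (SimpleGraph.mulCayley T₀) (SimpleGraph.mulCayley T₀) L C f →
        IsGroupPairQuasiIsometryWith T₀ T₀ Qs Qs L C M f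

/-- A connected graph is (Gromov) hyperbolic: for some `δ`, all geodesic triangles are `δ`-slim. -/
def IsHyperbolicGraph {V : Type*} (Γ : SimpleGraph V) : Prop :=
  Γ.Connected ∧ ∃ δ : ℕ, ∀ (x y z : V) (a : Γ.Walk x y) (b : Γ.Walk y z) (c : Γ.Walk x z),
    a.length = Γ.dist x y → b.length = Γ.dist y z → c.length = Γ.dist x z →
      ∀ v ∈ a.support, ∃ w, (w ∈ b.support ∨ w ∈ c.support) ∧ Γ.dist v w ≤ δ

/-- The graph `Γ(G, X ⊔ Ps)` with the edges of `Γ(P, P)` removed, that is, without the edges that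
are labelled by an element of `P` and join two elements of `P`. An edge between two elements of `P`
that is labelled by an element of `X`, or of a subgroup in `Ps` other than `P`, is kept. -/
def relativeGraph {G : Type*} [Group G] (Ps : Set (Subgroup G)) (X : Set G) (P : Subgroup G) :
    SimpleGraph G where
  Adj g h := g ≠ h ∧ (g⁻¹ * h ∈ X ∨ h⁻¹ * g ∈ X ∨
    ∃ Q ∈ Ps, g⁻¹ * h ∈ Q ∧ ¬ (Q = P ∧ g ∈ P ∧ h ∈ P))
  symm := ⟨by
    rintro g h ⟨hne, hX | hX | ⟨Q, hQ, hgh, hP⟩⟩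
    · exact ⟨hne.symm, Or.inr (Or.inl hX)⟩
    · exact ⟨hne.symm, Or.inl hX⟩
    · refine ⟨hne.symm, Or.inr (Or.inr ⟨Q, hQ, ?_, fun h' => hP ⟨h'.1, h'.2.2, h'.2.1⟩⟩)⟩
      simpa using Q.inv_mem hgh⟩
  loopless := ⟨fun _ h => h.1 rfl⟩

/-- `Ps ↪_h (G, X)`: the collection `Ps` is hyperbolically embedded in `G` with respect to `X`. That
is, `X` together with the members of `Ps` generates `G`, the Cayley graph `Γ(G, X ⊔ Ps)` is
hyperbolic, and for every `P ∈ Ps` the relative metric on `P` (the path metric of `relativeGraph`,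
with values in `[0, ∞]`) is locally finite. -/
def HyperbolicallyEmbedded {G : Type*} [Group G] (Ps : Set (Subgroup G)) (X : Set G) : Prop :=
  Subgroup.closure (X ∪ ⋃ P ∈ Ps, (P : Set G)) = ⊤ ∧
    IsHyperbolicGraph (SimpleGraph.mulCayley (X ∪ ⋃ P ∈ Ps, (P : Set G))) ∧
    ∀ P ∈ Ps, ∀ g ∈ P, ∀ n : ℕ, {h : G | h ∈ P ∧ (relativeGraph Ps X P).edist g h ≤ n}.Finite

/-!
Let `r` be a quasi-inverse of `q`. For `g : G` the map `q ∘ (g * ·) ∘ r` is a quasi-isometry of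
`H` with constants independent of `g`. As `Qs` is qi-characteristic, the family `𝒜` of the sets
`r '' B`, for `B` a coset of `Qs`, is therefore invariant under `G` up to a bounded Hausdorff
distance. It is locally finite, and by the finite index condition on commensurators two of its
members at finite Hausdorff distance are at bounded distance. Such a family consists, coarsely, of
cosets: each `A ∈ 𝒜` is close to its coarse stabilizer, the
group of all `g` with `g • A` at finite Hausdorff distance from `A`
(`exists_hausdorffDistLE_coarseStabilizer`). Let `Ps` consist of the coarse stabilizers
of one member of `𝒜` for each `G`-orbit of coarse classes. Then `q` is a quasi-isometry of pairs,
and distinct cosets of `Ps` are at infinite Hausdorff distance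
(`exists_subgroups_of_coarselyInvariant`, `exists_subgroups_of_isQICharacteristic`).

Hyperbolic embeddedness is transported along `q`. Both `q` and `r` are Lipschitz for the coned-off
Cayley graphs, in which the cosets of `Ps` and `Qs` have diameter at most `1`, so hyperbolicity
follows from its quasi-isometry invariance (`isHyperbolicGraph_conedOff`). That invariance,
`IsHyperbolicGraph.of_quasiIsometricEmbedding`, is deduced from the Morse lemma for
quasi-geodesics, proved here for graphs by the exponential divergence of geodesics. For local
finiteness of the relative metrics (`finite_relativeGraph_ball`), an edge of the relative graph of
`P` labelled by a member of `Ps` lies in a coset at infinite Hausdorff distance from `P`. Hence `q`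
maps it near a coset of `Qs` other than the one near `q '' P`, and paths in the relative graph of
`P` are mapped to paths of proportional length in a translate of a relative graph of `Qs`.
-/

/-! ### Slimness in terms of metric intervals -/

/-- `w` lies on some geodesic from `x` to `y`. -/
def LiesBetween {V : Type*} (Γ : SimpleGraph V) (x w y : V) : Prop :=
  Γ.dist x w + Γ.dist w y = Γ.dist x y

/-- A form of `δ`-slimness of geodesic triangles which does not mention walks: each side of a
triangle is replaced by the union of all geodesics between its end points. -/
def IsIntervalSlim {V : Type*} (Γ : SimpleGraph V) (δ : ℕ) : Prop :=
  ∀ x y z v : V, LiesBetween Γ x v y →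
    ∃ w, (LiesBetween Γ x w z ∨ LiesBetween Γ y w z) ∧ Γ.dist v w ≤ δ

section Intervals

variable {V : Type*} {Γ : SimpleGraph V}

theorem LiesBetween.symm {x w y : V} (h : LiesBetween Γ x w y) : LiesBetween Γ y w x := by
  unfold LiesBetween at *
  rw [Γ.dist_comm (u := y) (v := w), Γ.dist_comm (u := w) (v := x), Γ.dist_comm (u := y) (v := x)]
  omega

theorem dist_getVert_of_length_eq_dist {x y : V} (hΓ : Γ.Connected) (c : Γ.Walk x y)
    (hc : c.length = Γ.dist x y) {i j : ℕ} (hij : i ≤ j) (hj : j ≤ c.length) :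
    Γ.dist (c.getVert i) (c.getVert j) = j - i := by
  have lip : ∀ k l : ℕ, Γ.dist (c.getVert k) (c.getVert (k + l)) ≤ l := by
    intro k l
    induction l with
    | zero => simp
    | succ l ih =>
      have h1 : Γ.dist (c.getVert (k + l)) (c.getVert (k + (l + 1))) ≤ 1 := by
        rcases lt_or_ge (k + l) c.length with h | h
        · exact (SimpleGraph.dist_eq_one_iff_adj.mpr (c.adj_getVert_succ h)).le
        · rw [c.getVert_of_length_le h, c.getVert_of_length_le (by omega)]
          simp
      have := hΓ.dist_triangle (u := c.getVert k) (v := c.getVert (k + l))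
        (w := c.getVert (k + (l + 1)))
      omega
  have h1 := lip 0 i
  have h2 := lip i (j - i)
  have h3 := lip j (c.length - j)
  rw [show i + (j - i) = j by omega] at h2
  rw [show j + (c.length - j) = c.length by omega, c.getVert_length] at h3
  rw [zero_add, c.getVert_zero] at h1
  have t1 := hΓ.dist_triangle (u := x) (v := c.getVert i) (w := y)
  have t2 := hΓ.dist_triangle (u := c.getVert i) (v := c.getVert j) (w := y)
  omega

theorem exists_geodesic (hΓ : Γ.Connected) (x y : V) :
    ∃ c : ℕ → V, c 0 = x ∧ c (Γ.dist x y) = y ∧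
      ∀ i j, i ≤ j → j ≤ Γ.dist x y → Γ.dist (c i) (c j) = j - i := by
  obtain ⟨c, hc⟩ := hΓ.exists_walk_length_eq_dist x y
  refine ⟨c.getVert, c.getVert_zero, by rw [← hc, c.getVert_length], fun i j hij hj => ?_⟩
  exact dist_getVert_of_length_eq_dist hΓ c hc hij (hc ▸ hj)

theorem liesBetween_of_mem_support (hΓ : Γ.Connected) {x y : V} (c : Γ.Walk x y)
    (hc : c.length = Γ.dist x y) {v : V} (hv : v ∈ c.support) : LiesBetween Γ x v y := by
  obtain ⟨i, rfl, hi⟩ := SimpleGraph.Walk.mem_support_iff_exists_getVert.mp hv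
  have h1 := dist_getVert_of_length_eq_dist hΓ c hc (Nat.zero_le i) hi
  have h2 := dist_getVert_of_length_eq_dist hΓ c hc hi le_rfl
  rw [c.getVert_zero] at h1
  rw [c.getVert_length] at h2
  unfold LiesBetween
  omega

theorem IsHyperbolicGraph.exists_isIntervalSlim (h : IsHyperbolicGraph Γ) :
    ∃ δ, IsIntervalSlim Γ δ := by
  obtain ⟨hΓ, δ, hδ⟩ := h
  refine ⟨δ, fun x y z v hv => ?_⟩
  obtain ⟨a₁, ha₁⟩ := hΓ.exists_walk_length_eq_dist x v
  obtain ⟨a₂, ha₂⟩ := hΓ.exists_walk_length_eq_dist v y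
  obtain ⟨b, hb⟩ := hΓ.exists_walk_length_eq_dist y z
  obtain ⟨c, hc⟩ := hΓ.exists_walk_length_eq_dist x z
  obtain ⟨w, hw, hvw⟩ := hδ x y z (a₁.append a₂) b c
    (by rw [SimpleGraph.Walk.length_append, ha₁, ha₂]; exact hv) hb hc v (by simp)
  refine ⟨w, ?_, hvw⟩
  rcases hw with hw | hw
  · exact Or.inr (liesBetween_of_mem_support hΓ b hb hw)
  · exact Or.inl (liesBetween_of_mem_support hΓ c hc hw)

/-- In an interval-slim graph, any two geodesics with the same end points are uniformly close:
compare `w` with the point of `c` at the same distance from `x`. -/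
theorem IsIntervalSlim.exists_mem_support (hΓ : Γ.Connected) {δ : ℕ} (hδ : IsIntervalSlim Γ δ)
    {x y w : V} (hw : LiesBetween Γ x w y) (c : Γ.Walk x y) (hc : c.length = Γ.dist x y) :
    ∃ u ∈ c.support, Γ.dist w u ≤ 2 * δ := by
  have hle : Γ.dist x w ≤ c.length := by unfold LiesBetween at hw; omega
  refine ⟨c.getVert (Γ.dist x w), c.getVert_mem_support _, ?_⟩
  set u := c.getVert (Γ.dist x w) with hu
  have h1 := dist_getVert_of_length_eq_dist hΓ c hc (Nat.zero_le (Γ.dist x w)) hle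
  have h2 := dist_getVert_of_length_eq_dist hΓ c hc hle le_rfl
  rw [c.getVert_zero, ← hu] at h1
  rw [c.getVert_length, ← hu] at h2
  obtain ⟨v, hv, hwv⟩ := hδ x y u w hw
  have t1 := hΓ.dist_triangle (u := w) (v := v) (w := u)
  have t2 := hΓ.dist_triangle (u := x) (v := v) (w := w)
  have t3 := hΓ.dist_triangle (u := y) (v := v) (w := w)
  have c1 := Γ.dist_comm (u := v) (v := w)
  have c2 := Γ.dist_comm (u := y) (v := w)
  have c3 := Γ.dist_comm (u := y) (v := u)
  unfold LiesBetween at hv hw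
  rcases hv with hv | hv <;> omega

theorem IsIntervalSlim.isHyperbolicGraph (hΓ : Γ.Connected) {δ : ℕ} (hδ : IsIntervalSlim Γ δ) :
    IsHyperbolicGraph Γ := by
  refine ⟨hΓ, 3 * δ, fun x y z a b c ha hb hc v hv => ?_⟩
  obtain ⟨w, hw, hvw⟩ := hδ x y z v (liesBetween_of_mem_support hΓ a ha hv)
  rcases hw with hw | hw
  · obtain ⟨u, hu, hwu⟩ := hδ.exists_mem_support hΓ hw c hc
    have := hΓ.dist_triangle (u := v) (v := w) (w := u)
    exact ⟨u, Or.inr hu, by omega⟩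
  · obtain ⟨u, hu, hwu⟩ := hδ.exists_mem_support hΓ hw b hb
    have := hΓ.dist_triangle (u := v) (v := w) (w := u)
    exact ⟨u, Or.inl hu, by omega⟩

/-! ### Stability of quasi-geodesics -/

/-- The points `p 0, …, p n` form a quasi-geodesic sequence with constant `K`. -/
def IsQuasiGeodesicSeq (Γ : SimpleGraph V) (K : ℕ) (p : ℕ → V) (n : ℕ) : Prop :=
  ∀ i j, i ≤ j → j ≤ n →
    Γ.dist (p i) (p j) ≤ K * (j - i) + K ∧ j - i ≤ K * Γ.dist (p i) (p j) + K

/-- Exponential divergence: a geodesic is contained in a neighbourhood of any chain of points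
joining its end points, of a radius logarithmic in the length of the chain. -/
theorem IsIntervalSlim.exists_dist_le_of_chain (hΓ : Γ.Connected) {δ : ℕ}
    (hδ : IsIntervalSlim Γ δ) (p : ℕ → V) (J k : ℕ) :
    ∀ a b, a ≤ b → b ≤ a + 2 ^ k → (∀ i, a ≤ i → i < b → Γ.dist (p i) (p (i + 1)) ≤ J) →
      ∀ w, LiesBetween Γ (p a) w (p b) → ∃ i, a ≤ i ∧ i ≤ b ∧ Γ.dist w (p i) ≤ k * δ + J := by
  induction k with
  | zero =>
    intro a b hab hb hJ w hw
    refine ⟨a, le_rfl, hab, ?_⟩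
    rw [Γ.dist_comm]
    have h : Γ.dist (p a) (p b) ≤ J := by
      rcases hab.eq_or_lt with rfl | h
      · simp
      · obtain rfl : b = a + 1 := by simp at hb; omega
        exact hJ a le_rfl h
    unfold LiesBetween at hw
    omega
  | succ k ih =>
    intro a b hab hb hJ w hw
    obtain ⟨m, ham, hmb, hm1, hm2⟩ : ∃ m, a ≤ m ∧ m ≤ b ∧ m ≤ a + 2 ^ k ∧ b ≤ m + 2 ^ k := by
      rw [pow_succ] at hb
      rcases le_total b (a + 2 ^ k) with h | h
      · exact ⟨b, hab, le_rfl, h, by omega⟩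
      · exact ⟨a + 2 ^ k, by omega, h, le_rfl, by omega⟩
    obtain ⟨v, hv, hwv⟩ := hδ _ _ (p m) w hw
    have key : ∃ i, a ≤ i ∧ i ≤ b ∧ Γ.dist v (p i) ≤ k * δ + J := by
      rcases hv with hv | hv
      · obtain ⟨i, h1, h2, h3⟩ := ih a m ham hm1 (fun i h1 h2 => hJ i h1 (by omega)) v hv
        exact ⟨i, h1, by omega, h3⟩
      · obtain ⟨i, h1, h2, h3⟩ := ih m b hmb hm2 (fun i h1 h2 => hJ i (by omega) h2) v hv.symm
        exact ⟨i, by omega, h2, h3⟩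
    obtain ⟨i, h1, h2, h3⟩ := key
    refine ⟨i, h1, h2, ?_⟩
    have := hΓ.dist_triangle (u := w) (v := v) (w := p i)
    rw [add_mul, one_mul]
    omega

theorem exists_forall_linear_le_two_pow (a b : ℕ) : ∃ k₀, ∀ k ≥ k₀, a * k + b ≤ 2 ^ k := by
  have sq : ∀ k : ℕ, 4 ≤ k → k * k ≤ 2 ^ k := by
    intro k hk
    induction k, hk using Nat.le_induction with
    | base => norm_num
    | succ k hk ih => rw [pow_succ]; nlinarith
  refine ⟨a + b + 4, fun k hk => le_trans ?_ (sq k (by omega))⟩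
  nlinarith

/-- A quantity `D` which is at most logarithmic in itself is bounded. -/
theorem exists_bound_of_log_bound (K δ : ℕ) :
    ∃ D₀, ∀ D, (∀ k, K * (6 * D) + K ≤ 2 ^ k → D ≤ (k + 2) * δ + 2 * K) → D ≤ D₀ := by
  obtain ⟨k₀, hk₀⟩ := exists_forall_linear_le_two_pow (6 * K * δ) (6 * K * (3 * δ + 2 * K) + K)
  refine ⟨(k₀ + 2) * δ + 2 * K, fun D hD => ?_⟩
  by_contra! hlt
  have all : ∀ k ≥ k₀, (k + 2) * δ + 2 * K < D := by
    intro k hk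
    induction k, hk using Nat.le_induction with
    | base => exact hlt
    | succ k hk ih =>
      by_contra! hle
      have h1 : 2 ^ k < K * (6 * D) + K := by
        by_contra! h
        exact absurd (hD k h) (by omega)
      have h2 := hk₀ k hk
      have h3 : K * (6 * D) ≤ K * (6 * ((k + 1 + 2) * δ + 2 * K)) := by gcongr
      nlinarith
  have hbig := all (max k₀ (K * (6 * D) + K)) (le_max_left _ _)
  have := hD (max k₀ (K * (6 * D) + K))
    ((le_max_right k₀ _).trans (Nat.lt_two_pow_self).le)
  omega

/-- From `w`, move `r` steps along a geodesic towards `e`, stopping at `e` if it is met before. -/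
theorem exists_liesBetween_dist_eq (hΓ : Γ.Connected) (e w : V) (r : ℕ) :
    ∃ y, LiesBetween Γ e y w ∧ Γ.dist y w ≤ r ∧ (Γ.dist y w = r ∨ y = e) := by
  obtain ⟨c, h0, h1, hc⟩ := exists_geodesic hΓ e w
  refine ⟨c (Γ.dist e w - r), ?_, ?_⟩
  · have a := hc 0 (Γ.dist e w - r) (Nat.zero_le _) (by omega)
    have b := hc (Γ.dist e w - r) (Γ.dist e w) (by omega) le_rfl
    rw [h0] at a
    rw [h1] at b
    unfold LiesBetween
    omega
  · have b := hc (Γ.dist e w - r) (Γ.dist e w) (by omega) le_rfl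
    rw [h1] at b
    rcases le_total r (Γ.dist e w) with h | h
    · exact ⟨by omega, Or.inl (by omega)⟩
    · exact ⟨by omega, Or.inr (by rw [Nat.sub_eq_zero_of_le h, h0])⟩

/-- One half of the Morse lemma: a geodesic stays uniformly close to every quasi-geodesic with the
same end points. Let `D` be the exact radius needed and `w` a point at distance `D` from the
quasi-geodesic. Cut the geodesic at distance `2 D` from `w` on both sides and join the cut points
to the quasi-geodesic by paths of length at most `D`. By slimness `w` is close to the part of the
quasi-geodesic in between, which has length linear in `D`; exponential divergence bounds `D`. -/
theorem IsIntervalSlim.exists_geodesic_near_quasiGeodesic (hΓ : Γ.Connected) {δ : ℕ}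
    (hδ : IsIntervalSlim Γ δ) (K : ℕ) :
    ∃ D, ∀ p n, IsQuasiGeodesicSeq Γ K p n → ∀ w, LiesBetween Γ (p 0) w (p n) →
      ∃ i ≤ n, Γ.dist w (p i) ≤ D := by
  classical
  obtain ⟨D₀, hD₀⟩ := exists_bound_of_log_bound K δ
  refine ⟨D₀, fun p n hp => ?_⟩
  have hex : ∃ D, ∀ w, LiesBetween Γ (p 0) w (p n) → ∃ i ≤ n, Γ.dist w (p i) ≤ D := by
    refine ⟨Γ.dist (p 0) (p n), fun w hw => ⟨0, Nat.zero_le _, ?_⟩⟩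
    rw [Γ.dist_comm]
    unfold LiesBetween at hw
    omega
  obtain ⟨D, hD, hmin⟩ : ∃ D, (∀ w, LiesBetween Γ (p 0) w (p n) → ∃ i ≤ n, Γ.dist w (p i) ≤ D) ∧
      ∀ E < D, ¬ ∀ w, LiesBetween Γ (p 0) w (p n) → ∃ i ≤ n, Γ.dist w (p i) ≤ E :=
    ⟨Nat.find hex, Nat.find_spec hex, fun E hE => Nat.find_min hex hE⟩
  suffices h : D ≤ D₀ by
    intro w hw
    obtain ⟨i, hi, hwi⟩ := hD w hw
    exact ⟨i, hi, hwi.trans h⟩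
  rcases Nat.eq_zero_or_pos D with rfl | hpos
  · exact Nat.zero_le _
  have hw := hmin (D - 1) (by omega)
  push Not at hw
  obtain ⟨w, hw, hfar⟩ := hw
  obtain ⟨y, hy, hyle, hyor⟩ := exists_liesBetween_dist_eq hΓ (p 0) w (2 * D)
  obtain ⟨z, hz, hzle, hzor⟩ := exists_liesBetween_dist_eq hΓ (p n) w (2 * D)
  have hyz : LiesBetween Γ y w z ∧ LiesBetween Γ (p 0) y (p n) ∧ LiesBetween Γ (p 0) z (p n) := by
    have t1 := hΓ.dist_triangle (u := p 0) (v := y) (w := p n)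
    have t2 := hΓ.dist_triangle (u := y) (v := z) (w := p n)
    have t3 := hΓ.dist_triangle (u := p 0) (v := z) (w := p n)
    have t4 := hΓ.dist_triangle (u := y) (v := w) (w := z)
    have t5 := hΓ.dist_triangle (u := y) (v := w) (w := p n)
    have t6 := hΓ.dist_triangle (u := p 0) (v := w) (w := z)
    have c1 := Γ.dist_comm (u := z) (v := w)
    have c2 := Γ.dist_comm (u := z) (v := p n)
    have c3 := Γ.dist_comm (u := w) (v := p n)
    unfold LiesBetween at *
    refine ⟨?_, ?_, ?_⟩ <;> omega
  obtain ⟨hywz, hyb, hzb⟩ := hyz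
  obtain ⟨i, hi, hyi, hi'⟩ : ∃ i ≤ n, Γ.dist y (p i) ≤ D ∧ (Γ.dist y w = 2 * D ∨ y = p i) := by
    rcases hyor with h | h
    · obtain ⟨i, hi, hyi⟩ := hD y hyb
      exact ⟨i, hi, hyi, Or.inl h⟩
    · exact ⟨0, Nat.zero_le _, by simp [h], Or.inr h⟩
  obtain ⟨j, hj, hzj, hj'⟩ : ∃ j ≤ n, Γ.dist z (p j) ≤ D ∧ (Γ.dist z w = 2 * D ∨ z = p j) := by
    rcases hzor with h | h
    · obtain ⟨i, hi, hyi⟩ := hD z hzb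
      exact ⟨i, hi, hyi, Or.inl h⟩
    · exact ⟨n, le_rfl, by simp [h], Or.inr h⟩
  -- A point of a connecting path which is close to `w` bounds `D`.
  have conn : ∀ y i u, i ≤ n → Γ.dist y (p i) ≤ D → (Γ.dist y w = 2 * D ∨ y = p i) →
      LiesBetween Γ y u (p i) → Γ.dist w u ≤ 2 * δ → D ≤ 2 * δ := by
    intro y i u hi hyi hor hu hwu
    have c1 := Γ.dist_comm (u := u) (v := w)
    have t1 := hΓ.dist_triangle (u := y) (v := u) (w := w)
    unfold LiesBetween at hu
    rcases hor with h | rfl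
    · omega
    · have h2 := hfar i hi
      rw [Γ.dist_self] at hu
      have t2 := hΓ.dist_triangle (u := w) (v := u) (w := p i)
      omega
  -- A point between `p i` and `p j` which is close to `w` bounds `D` by exponential divergence.
  have mid : ∀ i j u, i ≤ j → j ≤ n → Γ.dist (p i) (p j) ≤ 6 * D → LiesBetween Γ (p i) u (p j) →
      Γ.dist w u ≤ 2 * δ → ∀ k, K * (6 * D) + K ≤ 2 ^ k → D ≤ (k + 2) * δ + 2 * K := by
    intro i j u hij hj hd hu hwu k hk
    have h1 := (hp i j hij hj).2
    have h2 : K * Γ.dist (p i) (p j) ≤ K * (6 * D) := Nat.mul_le_mul_left _ hd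
    obtain ⟨l, hl1, hl2, hl⟩ := hδ.exists_dist_le_of_chain hΓ p (2 * K) k i j hij (by omega)
      (fun m hm1 hm2 => by
        have := (hp m (m + 1) (by omega) (by omega)).1
        simp only [Nat.add_sub_cancel_left] at this
        omega) u hu
    have h3 := hfar l (by omega)
    have t := hΓ.dist_triangle (u := w) (v := u) (w := p l)
    rw [add_mul]
    omega
  have hij : Γ.dist (p i) (p j) ≤ 6 * D := by
    have t1 := hΓ.dist_triangle (u := p i) (v := y) (w := p j)
    have t2 := hΓ.dist_triangle (u := y) (v := w) (w := p j)
    have t3 := hΓ.dist_triangle (u := w) (v := z) (w := p j)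
    have c1 := Γ.dist_comm (u := p i) (v := y)
    have c2 := Γ.dist_comm (u := w) (v := z)
    omega
  refine hD₀ D fun k hk => ?_
  have easy : D ≤ 2 * δ → D ≤ (k + 2) * δ + 2 * K := fun h => by rw [add_mul]; omega
  obtain ⟨u, hu, hwu⟩ := hδ y z (p i) w hywz
  rcases hu with hu | hu
  · exact easy (conn y i u hi hyi hi' hu (by omega))
  · obtain ⟨v, hv, huv⟩ := hδ z (p i) (p j) u hu
    have hwv : Γ.dist w v ≤ 2 * δ := by
      have := hΓ.dist_triangle (u := w) (v := u) (w := v)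
      omega
    rcases hv with hv | hv
    · exact easy (conn z j v hj hzj hj' hv hwv)
    · rcases le_total i j with h | h
      · exact mid i j v h hj hij hv hwv k hk
      · exact mid j i v h hi (by rwa [Γ.dist_comm]) hv.symm hwv k hk

/-- The other half of the Morse lemma: a quasi-geodesic stays uniformly close to a geodesic with
the same end points. Along the geodesic, the nearby points of the quasi-geodesic have to jump from
indices `≤ m` to indices `> m`, and there `p m` is close. -/
theorem IsIntervalSlim.exists_quasiGeodesic_near_geodesic (hΓ : Γ.Connected) {δ : ℕ}
    (hδ : IsIntervalSlim Γ δ) (K : ℕ) :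
    ∃ D, ∀ p n, IsQuasiGeodesicSeq Γ K p n → ∀ m ≤ n, ∃ w, LiesBetween Γ (p 0) w (p n) ∧
      Γ.dist (p m) w ≤ D := by
  classical
  obtain ⟨D, hD⟩ := hδ.exists_geodesic_near_quasiGeodesic hΓ K
  refine ⟨K * (K * (2 * D + 1) + K) + K + D, fun p n hp m hm => ?_⟩
  obtain ⟨c, h0, h1, hc⟩ := exists_geodesic hΓ (p 0) (p n)
  set l := Γ.dist (p 0) (p n) with hl
  have hbtw : ∀ t ≤ l, LiesBetween Γ (p 0) (c t) (p n) := by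
    intro t ht
    have a := hc 0 t (Nat.zero_le _) ht
    have b := hc t l ht le_rfl
    rw [h0] at a
    rw [h1] at b
    unfold LiesBetween
    omega
  have near : ∀ t ≤ l, ∀ i ≤ m, Γ.dist (c t) (p i) ≤ D → m - i ≤ K * (2 * D + 1) + K →
      Γ.dist (p m) (c t) ≤ K * (K * (2 * D + 1) + K) + K + D := by
    intro t ht i hi hti hmi
    have a := (hp i m hi hm).1
    have b : K * (m - i) ≤ K * (K * (2 * D + 1) + K) := Nat.mul_le_mul_left _ hmi
    have t1 := hΓ.dist_triangle (u := p m) (v := p i) (w := c t)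
    have c1 := Γ.dist_comm (u := p m) (v := p i)
    have c2 := Γ.dist_comm (u := p i) (v := c t)
    omega
  by_cases hR : ∃ i ≤ m, Γ.dist (c l) (p i) ≤ D
  · obtain ⟨i, hi, hti⟩ := hR
    refine ⟨c l, hbtw l le_rfl, near l le_rfl i hi hti ?_⟩
    rw [h1, Γ.dist_comm] at hti
    have a := (hp i n (hi.trans hm) le_rfl).2
    have b : K * Γ.dist (p i) (p n) ≤ K * (2 * D + 1) := Nat.mul_le_mul_left _ (by omega)
    omega
  · obtain ⟨t, ht, ⟨i, hi, hti⟩, hnot⟩ : ∃ t < l, (∃ i ≤ m, Γ.dist (c t) (p i) ≤ D) ∧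
        ¬ ∃ i ≤ m, Γ.dist (c (t + 1)) (p i) ≤ D := by
      by_contra! hcon
      refine hR ?_
      have : ∀ t ≤ l, ∃ i ≤ m, Γ.dist (c t) (p i) ≤ D := by
        intro t
        induction t with
        | zero => exact fun _ => ⟨0, Nat.zero_le _, by simp [h0]⟩
        | succ t ih => exact fun ht => hcon t (by omega) (ih (by omega))
      exact this l le_rfl
    refine ⟨c t, hbtw t ht.le, near t ht.le i hi hti ?_⟩
    obtain ⟨j, hj, htj⟩ := hD p n hp (c (t + 1)) (hbtw _ ht)
    have hmj : m < j := by
      by_contra! h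
      exact hnot ⟨j, h, htj⟩
    have a := (hp i j (by omega) hj).2
    have s := hc t (t + 1) (by omega) ht
    have t1 := hΓ.dist_triangle (u := p i) (v := c t) (w := p j)
    have t2 := hΓ.dist_triangle (u := c t) (v := c (t + 1)) (w := p j)
    have c1 := Γ.dist_comm (u := p i) (v := c t)
    have b : K * Γ.dist (p i) (p j) ≤ K * (2 * D + 1) := Nat.mul_le_mul_left _ (by omega)
    omega

/-- Hyperbolicity passes back along quasi-isometric embeddings of connected graphs. -/
theorem IsHyperbolicGraph.of_quasiIsometricEmbedding {W : Type*} {Δ : SimpleGraph W}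
    (hΔ : IsHyperbolicGraph Δ) (hΓ : Γ.Connected) (f : V → W) (K : ℕ)
    (hf : ∀ x y, Δ.dist (f x) (f y) ≤ K * Γ.dist x y + K)
    (hf' : ∀ x y, Γ.dist x y ≤ K * Δ.dist (f x) (f y) + K) : IsHyperbolicGraph Γ := by
  obtain ⟨δ, hδ⟩ := hΔ.exists_isIntervalSlim
  obtain ⟨D₁, hD₁⟩ := hδ.exists_geodesic_near_quasiGeodesic hΔ.1 K
  obtain ⟨D₂, hD₂⟩ := hδ.exists_quasiGeodesic_near_geodesic hΔ.1 K
  have qg : ∀ (c : ℕ → V) n, (∀ i j, i ≤ j → j ≤ n → Γ.dist (c i) (c j) = j - i) →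
      IsQuasiGeodesicSeq Δ K (f ∘ c) n := by
    intro c n hc i j hij hj
    have h1 := hf (c i) (c j)
    have h2 := hf' (c i) (c j)
    rw [hc i j hij hj] at h1 h2
    exact ⟨h1, h2⟩
  -- images of points between `x` and `y` are near points between `f x` and `f y`, and conversely
  have push : ∀ x y v, LiesBetween Γ x v y →
      ∃ w, LiesBetween Δ (f x) w (f y) ∧ Δ.dist (f v) w ≤ D₂ := by
    intro x y v hv
    obtain ⟨a, ha⟩ := hΓ.exists_walk_length_eq_dist x v
    obtain ⟨b, hb⟩ := hΓ.exists_walk_length_eq_dist v y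
    have hab : (a.append b).length = Γ.dist x y := by
      rw [SimpleGraph.Walk.length_append, ha, hb]; exact hv
    obtain ⟨m, hm, hml⟩ := SimpleGraph.Walk.mem_support_iff_exists_getVert.mp
      (show v ∈ (a.append b).support by simp)
    obtain ⟨w, hw, hmw⟩ := hD₂ _ _ (qg (a.append b).getVert (a.append b).length
      fun i j hij hj => dist_getVert_of_length_eq_dist hΓ _ hab hij hj) m hml
    simp only [Function.comp_apply, SimpleGraph.Walk.getVert_zero, SimpleGraph.Walk.getVert_length,
      hm] at hw hmw
    exact ⟨w, hw, hmw⟩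
  have pull : ∀ x y w, LiesBetween Δ (f x) w (f y) →
      ∃ v, LiesBetween Γ x v y ∧ Δ.dist w (f v) ≤ D₁ := by
    intro x y w hw
    obtain ⟨c, h0, h1, hc⟩ := exists_geodesic hΓ x y
    obtain ⟨i, hi, hwi⟩ := hD₁ _ _ (qg c _ hc) w (by simpa only [Function.comp_apply, h0, h1])
    refine ⟨c i, ?_, hwi⟩
    have a := hc 0 i (Nat.zero_le _) hi
    have b := hc i _ hi le_rfl
    rw [h0] at a
    rw [h1] at b
    unfold LiesBetween
    omega
  refine IsIntervalSlim.isHyperbolicGraph hΓ (δ := K * (D₂ + δ + D₁) + K) fun x y z v hv => ?_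
  obtain ⟨w, hw, hvw⟩ := push x y v hv
  obtain ⟨u, hu, hwu⟩ := hδ _ _ (f z) w hw
  obtain ⟨v', hv', huv'⟩ : ∃ v', (LiesBetween Γ x v' z ∨ LiesBetween Γ y v' z) ∧
      Δ.dist u (f v') ≤ D₁ := by
    rcases hu with hu | hu
    · obtain ⟨v', h1, h2⟩ := pull x z u hu
      exact ⟨v', Or.inl h1, h2⟩
    · obtain ⟨v', h1, h2⟩ := pull y z u hu
      exact ⟨v', Or.inr h1, h2⟩
  refine ⟨v', hv', (hf' v v').trans ?_⟩
  have t1 := hΔ.1.dist_triangle (u := f v) (v := w) (w := f v')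
  have t2 := hΔ.1.dist_triangle (u := w) (v := u) (w := f v')
  gcongr
  omega

end Intervals

/-! ### Coarse geometry of subsets -/

/-- The sets `A` and `B` are at Hausdorff distance at most `n`. -/
def HausdorffDistLE {V : Type*} (Γ : SimpleGraph V) (n : ℕ) (A B : Set V) : Prop :=
  (∀ a ∈ A, ∃ b ∈ B, Γ.dist a b ≤ n) ∧ ∀ b ∈ B, ∃ a ∈ A, Γ.dist a b ≤ n

section HausdorffDist

variable {V W : Type*} {Γ : SimpleGraph V} {Δ : SimpleGraph W}

theorem HausdorffDistLE.symm {n : ℕ} {A B : Set V} (h : HausdorffDistLE Γ n A B) :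
    HausdorffDistLE Γ n B A := by
  refine ⟨fun b hb => ?_, fun a ha => ?_⟩
  · obtain ⟨a, ha, hab⟩ := h.2 b hb
    exact ⟨a, ha, by rwa [Γ.dist_comm]⟩
  · obtain ⟨b, hb, hab⟩ := h.1 a ha
    exact ⟨b, hb, by rwa [Γ.dist_comm]⟩

theorem HausdorffDistLE.trans (hΓ : Γ.Connected) {m n : ℕ} {A B C : Set V}
    (h : HausdorffDistLE Γ m A B) (h' : HausdorffDistLE Γ n B C) :
    HausdorffDistLE Γ (m + n) A C := by
  refine ⟨fun a ha => ?_, fun c hc => ?_⟩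
  · obtain ⟨b, hb, hab⟩ := h.1 a ha
    obtain ⟨c, hc, hbc⟩ := h'.1 b hb
    exact ⟨c, hc, hΓ.dist_triangle.trans (add_le_add hab hbc)⟩
  · obtain ⟨b, hb, hbc⟩ := h'.2 c hc
    obtain ⟨a, ha, hab⟩ := h.2 b hb
    exact ⟨a, ha, hΓ.dist_triangle.trans (add_le_add hab hbc)⟩

theorem HausdorffDistLE.mono {m n : ℕ} (hmn : m ≤ n) {A B : Set V}
    (h : HausdorffDistLE Γ m A B) : HausdorffDistLE Γ n A B := by
  refine ⟨fun a ha => ?_, fun b hb => ?_⟩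
  · obtain ⟨b, hb, hab⟩ := h.1 a ha
    exact ⟨b, hb, hab.trans hmn⟩
  · obtain ⟨a, ha, hab⟩ := h.2 b hb
    exact ⟨a, ha, hab.trans hmn⟩

theorem HausdorffDistLE.refl (A : Set V) : HausdorffDistLE Γ 0 A A :=
  ⟨fun a ha => ⟨a, ha, by simp⟩, fun a ha => ⟨a, ha, by simp⟩⟩

theorem HausdorffDistLE.image {f : V → W} {K n : ℕ} {A B : Set V}
    (hf : ∀ x y, Δ.dist (f x) (f y) ≤ K * Γ.dist x y + K) (h : HausdorffDistLE Γ n A B) :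
    HausdorffDistLE Δ (K * n + K) (f '' A) (f '' B) := by
  have bd : ∀ {x y}, Γ.dist x y ≤ n → Δ.dist (f x) (f y) ≤ K * n + K := fun hxy =>
    (hf _ _).trans (by gcongr)
  constructor
  · rintro _ ⟨a, ha, rfl⟩
    obtain ⟨b, hb, hab⟩ := h.1 a ha
    exact ⟨f b, ⟨b, hb, rfl⟩, bd hab⟩
  · rintro _ ⟨b, hb, rfl⟩
    obtain ⟨a, ha, hab⟩ := h.2 b hb
    exact ⟨f a, ⟨a, ha, rfl⟩, bd hab⟩

theorem HausdorffDistLE.of_image {f : V → W} {K n : ℕ} {A B : Set V}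
    (hf : ∀ x y, Γ.dist x y ≤ K * Δ.dist (f x) (f y) + K)
    (h : HausdorffDistLE Δ n (f '' A) (f '' B)) : HausdorffDistLE Γ (K * n + K) A B := by
  have bd : ∀ {x y}, Δ.dist (f x) (f y) ≤ n → Γ.dist x y ≤ K * n + K := fun hxy =>
    (hf _ _).trans (by gcongr)
  constructor
  · intro a ha
    obtain ⟨_, ⟨b, hb, rfl⟩, hab⟩ := h.1 _ ⟨a, ha, rfl⟩
    exact ⟨b, hb, bd hab⟩
  · intro b hb
    obtain ⟨_, ⟨a, ha, rfl⟩, hab⟩ := h.2 _ ⟨b, hb, rfl⟩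
    exact ⟨a, ha, bd hab⟩

theorem HausdorffDistLT.exists_hausdorffDistLE {A B : Set V} {M : ℝ}
    (h : HausdorffDistLT Γ A B M) : HausdorffDistLE Γ ⌈M⌉₊ A B := by
  obtain ⟨r, hr, h1, h2⟩ := h
  have bd : ∀ {a b}, (Γ.dist a b : ℝ) ≤ r → Γ.dist a b ≤ ⌈M⌉₊ := fun hab => by
    exact_mod_cast (hab.trans hr.le).trans (Nat.le_ceil M)
  refine ⟨fun a ha => ?_, fun b hb => ?_⟩
  · obtain ⟨b, hb, hab⟩ := h1 a ha
    exact ⟨b, hb, bd hab⟩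
  · obtain ⟨a, ha, hab⟩ := h2 b hb
    exact ⟨a, ha, bd hab⟩

theorem HausdorffDistLE.hausdorffDistLT {n : ℕ} {A B : Set V} (h : HausdorffDistLE Γ n A B) :
    HausdorffDistLT Γ A B (n + 1) := by
  refine ⟨n, by linarith, fun a ha => ?_, fun b hb => ?_⟩
  · obtain ⟨b, hb, hab⟩ := h.1 a ha
    exact ⟨b, hb, by exact_mod_cast hab⟩
  · obtain ⟨a, ha, hab⟩ := h.2 b hb
    exact ⟨a, ha, by exact_mod_cast hab⟩

end HausdorffDist

/-! ### Lipschitz maps of graphs and word metrics -/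

section Lipschitz

variable {V W : Type*} {Γ : SimpleGraph V} {Δ : SimpleGraph W}

theorem edist_map_le_of_walk {f : V → W} {K : ℕ}
    (hf : ∀ x y, Γ.Adj x y → Δ.edist (f x) (f y) ≤ K) {x y : V} (p : Γ.Walk x y) :
    Δ.edist (f x) (f y) ≤ (K * p.length : ℕ) := by
  induction p with
  | nil => simp
  | cons h p ih =>
    refine SimpleGraph.edist_triangle.trans ((add_le_add (hf _ _ h) ih).trans ?_)
    rw [SimpleGraph.Walk.length_cons, mul_add, mul_one, add_comm (K * _)]
    exact_mod_cast le_rfl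

theorem dist_map_le {f : V → W} {K : ℕ} (hΓ : Γ.Connected) (hΔ : Δ.Connected)
    (hf : ∀ x y, Γ.Adj x y → Δ.dist (f x) (f y) ≤ K) (x y : V) :
    Δ.dist (f x) (f y) ≤ K * Γ.dist x y := by
  obtain ⟨p, hp⟩ := hΓ.exists_walk_length_eq_dist x y
  have h := edist_map_le_of_walk (Δ := Δ) (f := f) (K := K) (fun x y hxy => by
    rw [← (hΔ (f x) (f y)).coe_dist_eq_edist]
    exact_mod_cast hf x y hxy) p
  rw [← (hΔ (f x) (f y)).coe_dist_eq_edist, hp] at h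
  exact_mod_cast h

theorem dist_le_of_le {Γ' : SimpleGraph V} (hΓ : Γ.Connected) (h : Γ ≤ Γ') (x y : V) :
    Γ'.dist x y ≤ Γ.dist x y :=
  (hΓ x y).dist_anti h

end Lipschitz

section WordMetric

variable {G : Type*} [Group G] {S : Set G}

theorem connected_mulCayley (hS : Subgroup.closure S = ⊤) :
    (SimpleGraph.mulCayley S).Connected := by
  have key : ∀ g : G, ∀ x : G, (SimpleGraph.mulCayley S).Reachable x (x * g) := by
    intro g
    have hg : g ∈ Subgroup.closure S := hS ▸ Subgroup.mem_top g
    induction hg using Subgroup.closure_induction with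
    | mem s hs =>
      intro x
      by_cases h : x = x * s
      · rw [← h]
      · exact SimpleGraph.Adj.reachable ((SimpleGraph.mulCayley_adj S _ _).mpr
          ⟨h, Or.inl (by simpa using hs)⟩)
    | one => intro x; simp
    | mul a b _ _ ha hb =>
      intro x
      rw [← mul_assoc]
      exact (ha x).trans (hb (x * a))
    | inv a _ ha =>
      intro x
      simpa using (ha (x * a⁻¹)).symm
  have : Nonempty G := ⟨1⟩
  exact ⟨fun x y => by simpa using key (x⁻¹ * y) x⟩

theorem dist_mulCayley_mul_left (hS : Subgroup.closure S = ⊤) (g x y : G) :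
    (SimpleGraph.mulCayley S).dist (g * x) (g * y) = (SimpleGraph.mulCayley S).dist x y := by
  have hc := connected_mulCayley hS
  have le : ∀ g x y : G,
      (SimpleGraph.mulCayley S).dist (g * x) (g * y) ≤ (SimpleGraph.mulCayley S).dist x y := by
    intro g x y
    have := dist_map_le (f := (g * ·)) (K := 1) hc hc (fun x y hxy =>
      (SimpleGraph.dist_eq_one_iff_adj.mpr
        (SimpleGraph.mulCayley_adj_mul_iff_right.mpr hxy)).le) x y
    simpa using this
  refine le_antisymm (le g x y) ?_
  simpa using le g⁻¹ (g * x) (g * y)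

theorem dist_mulCayley_one (hS : Subgroup.closure S = ⊤) (x y : G) :
    (SimpleGraph.mulCayley S).dist 1 (x⁻¹ * y) = (SimpleGraph.mulCayley S).dist x y := by
  rw [← dist_mulCayley_mul_left hS x]
  simp

theorem HausdorffDistLE.smul (hS : Subgroup.closure S = ⊤) {n : ℕ} {A B : Set G}
    (h : HausdorffDistLE (SimpleGraph.mulCayley S) n A B) (g : G) :
    HausdorffDistLE (SimpleGraph.mulCayley S) n (g • A) (g • B) := by
  constructor
  · rintro _ ⟨a, ha, rfl⟩
    obtain ⟨b, hb, hab⟩ := h.1 a ha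
    exact ⟨g • b, Set.smul_mem_smul_set hb, by
      simpa only [smul_eq_mul, dist_mulCayley_mul_left hS] using hab⟩
  · rintro _ ⟨b, hb, rfl⟩
    obtain ⟨a, ha, hab⟩ := h.2 b hb
    exact ⟨g • a, Set.smul_mem_smul_set ha, by
      simpa only [smul_eq_mul, dist_mulCayley_mul_left hS] using hab⟩

theorem finite_ball_mulCayley (hfin : S.Finite) (hS : Subgroup.closure S = ⊤) (x : G) (n : ℕ) :
    {y | (SimpleGraph.mulCayley S).dist x y ≤ n}.Finite := by
  have hc := connected_mulCayley hS
  have one : {y | (SimpleGraph.mulCayley S).dist 1 y ≤ n}.Finite := by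
    induction n with
    | zero =>
      refine (Set.finite_singleton (1 : G)).subset fun y hy => ?_
      have : (SimpleGraph.mulCayley S).dist 1 y = 0 := by simpa using hy
      exact (hc.dist_eq_zero_iff.mp this).symm
    | succ n ih =>
      refine ((ih.mul (hfin.union hfin.inv)).union ih).subset fun y hy => ?_
      obtain ⟨c, h0, h1, hd⟩ := exists_geodesic hc 1 y
      set l := (SimpleGraph.mulCayley S).dist 1 y with hl
      have hy : l ≤ n + 1 := hy
      rcases Nat.lt_or_ge n l with h | h
      · left
        have e1 := hd 0 (l - 1) (by omega) (by omega)
        have e2 := hd (l - 1) l (by omega) le_rfl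
        rw [h0] at e1
        rw [h1, show l - (l - 1) = 1 by omega] at e2
        obtain ⟨-, hs⟩ := (SimpleGraph.mulCayley_adj S _ _).mp
          (SimpleGraph.dist_eq_one_iff_adj.mp e2)
        refine ⟨c (l - 1), ?_, (c (l - 1))⁻¹ * y, ?_, by simp⟩
        · change (SimpleGraph.mulCayley S).dist 1 _ ≤ n
          omega
        · rcases hs with hs | hs
          · exact Or.inl hs
          · exact Or.inr (by simpa using hs)
      · exact Or.inr h
  refine (one.preimage (f := fun y => x⁻¹ * y)
    (mul_right_injective x⁻¹).injOn).subset fun y hy => ?_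
  simpa [dist_mulCayley_one hS] using hy

end WordMetric

/-! ### Subgroups from a coarsely invariant family of subsets -/

section CoarseStabilizer

variable {G : Type*} [Group G] {S : Set G}

/-- The coarse stabilizer of `A`: the elements which move `A` by a finite Hausdorff distance. -/
def coarseStabilizer (hS : Subgroup.closure S = ⊤) (A : Set G) : Subgroup G where
  carrier := {g | ∃ n, HausdorffDistLE (SimpleGraph.mulCayley S) n (g • A) A}
  one_mem' := ⟨0, by simpa using HausdorffDistLE.refl A⟩
  mul_mem' := by
    rintro g h ⟨m, hm⟩ ⟨n, hn⟩
    exact ⟨n + m, by simpa [mul_smul] using (hn.smul hS g).trans (connected_mulCayley hS) hm⟩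
  inv_mem' := by
    rintro g ⟨n, hn⟩
    exact ⟨n, by simpa using (hn.smul hS g⁻¹).symm⟩

theorem exists_bound_of_finite {α : Type*} {s : Set α} (hs : s.Finite) (p : α → ℕ → Prop)
    (hp : ∀ a m n, m ≤ n → p a m → p a n) (h : ∀ a ∈ s, ∃ n, p a n) :
    ∃ N, ∀ a ∈ s, p a N := by
  choose! f hf using h
  obtain ⟨N, hN⟩ := (hs.image f).bddAbove
  exact ⟨N, fun a ha => hp a _ _ (hN ⟨a, ha, rfl⟩) (hf a ha)⟩

/-- Each member `A` of a coarsely invariant, locally finite family is close to its coarse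
stabilizer. For `x ∈ A` the set `x⁻¹ • A` is close to one of the finitely many members of the family
near `1`, and two points `x, y` with the same such member give `x * y⁻¹` in the stabilizer. -/
theorem exists_hausdorffDistLE_coarseStabilizer (hS : Subgroup.closure S = ⊤)
    {𝒜 : Set (Set G)} {M : ℕ} {A : Set G} (hA : A ∈ 𝒜) (hne : A.Nonempty)
    (hinv : ∀ A ∈ 𝒜, ∀ g : G, ∃ A' ∈ 𝒜, HausdorffDistLE (SimpleGraph.mulCayley S) M (g • A) A')
    (hfin : {A ∈ 𝒜 | ∃ a ∈ A, (SimpleGraph.mulCayley S).dist 1 a ≤ M}.Finite)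
    (hbdd : ∃ D, ∀ A' ∈ 𝒜, (∃ n, HausdorffDistLE (SimpleGraph.mulCayley S) n A A') →
      HausdorffDistLE (SimpleGraph.mulCayley S) D A A') :
    ∃ N, HausdorffDistLE (SimpleGraph.mulCayley S) N A (coarseStabilizer hS A) := by
  have hc := connected_mulCayley hS
  set Γ := SimpleGraph.mulCayley S with hΓ
  obtain ⟨N₁, hN₁⟩ := exists_bound_of_finite hfin
    (fun A' n => (∃ x : G, HausdorffDistLE Γ M (x⁻¹ • A) A') →
      ∃ x : G, HausdorffDistLE Γ M (x⁻¹ • A) A' ∧ Γ.dist 1 x⁻¹ ≤ n)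
    (fun A' m n hmn h hx => (h hx).imp fun x hx => ⟨hx.1, hx.2.trans hmn⟩)
    (fun A' _ => by
      by_cases h : ∃ x : G, HausdorffDistLE Γ M (x⁻¹ • A) A'
      · exact ⟨Γ.dist 1 h.choose⁻¹, fun _ => ⟨_, h.choose_spec, le_rfl⟩⟩
      · exact ⟨0, fun h' => absurd h' h⟩)
  obtain ⟨D, hD⟩ := hbdd
  obtain ⟨x₀, hx₀⟩ := hne
  refine ⟨max N₁ (Γ.dist 1 x₀ + (M + D)), fun x hx => ?_, ?_⟩
  · obtain ⟨A', hA', hxA'⟩ := hinv A hA x⁻¹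
    have h1 : (1 : G) ∈ x⁻¹ • A := ⟨x, hx, by simp⟩
    obtain ⟨a, ha, h1a⟩ := hxA'.1 1 h1
    obtain ⟨y, hy, hyN⟩ := hN₁ A' ⟨hA', a, ha, h1a⟩ ⟨x, hxA'⟩
    refine ⟨x * y⁻¹, ⟨M + M, ?_⟩, ?_⟩
    · simpa [mul_smul] using ((hy.trans hc hxA'.symm).smul hS x)
    · have := dist_mulCayley_mul_left hS x 1 y⁻¹
      rw [mul_one] at this
      rw [hΓ, this]
      exact hyN.trans (le_max_left _ _)
  · rintro g ⟨n, hn⟩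
    obtain ⟨A', hA', hgA'⟩ := hinv A hA g
    have h := hgA'.trans hc (hD A' hA' ⟨n + M, hn.symm.trans hc hgA'⟩).symm
    obtain ⟨a, ha, hga⟩ := h.1 (g • x₀) (Set.smul_mem_smul_set hx₀)
    refine ⟨a, ha, ?_⟩
    have h2 := dist_mulCayley_mul_left hS g 1 x₀
    rw [mul_one, ← hΓ] at h2
    have h3 := hc.dist_triangle (u := g) (v := g * x₀) (w := a)
    rw [smul_eq_mul] at hga
    rw [Γ.dist_comm]
    exact (h3.trans (add_le_add h2.le hga)).trans (le_max_right _ _)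

/-- A coarsely invariant, locally finite family of subsets of `G` is, up to bounded Hausdorff
distance, the family of cosets of finitely many subgroups, and distinct cosets are at infinite
Hausdorff distance. The subgroups are the coarse stabilizers of one member of the family near `1`
for each orbit of `G` on the classes of members at finite Hausdorff distance. -/
theorem exists_subgroups_of_coarselyInvariant (hS : Subgroup.closure S = ⊤)
    {𝒜 : Set (Set G)} {M : ℕ} (hne : ∀ A ∈ 𝒜, A.Nonempty)
    (hinv : ∀ A ∈ 𝒜, ∀ g : G, ∃ A' ∈ 𝒜, HausdorffDistLE (SimpleGraph.mulCayley S) M (g • A) A')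
    (hfin : {A ∈ 𝒜 | ∃ a ∈ A, (SimpleGraph.mulCayley S).dist 1 a ≤ M}.Finite)
    (hbdd : ∀ A ∈ 𝒜, ∃ D, ∀ A' ∈ 𝒜, (∃ n, HausdorffDistLE (SimpleGraph.mulCayley S) n A A') →
      HausdorffDistLE (SimpleGraph.mulCayley S) D A A') :
    ∃ Ps : Set (Subgroup G), Ps.Finite ∧
      (∃ N, (∀ A ∈ 𝒜, ∃ B ∈ cosetsOf Ps, HausdorffDistLE (SimpleGraph.mulCayley S) N B A) ∧
        ∀ B ∈ cosetsOf Ps, ∃ A ∈ 𝒜, HausdorffDistLE (SimpleGraph.mulCayley S) N B A) ∧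
      ∀ B ∈ cosetsOf Ps, ∀ B' ∈ cosetsOf Ps, ∀ n,
        HausdorffDistLE (SimpleGraph.mulCayley S) n B B' → B = B' := by
  have hc := connected_mulCayley hS
  set Γ := SimpleGraph.mulCayley S with hΓ
  set F : Set (Set G) := {A ∈ 𝒜 | ∃ a ∈ A, Γ.dist 1 a ≤ M} with hF
  -- the equivalence relation whose classes are the orbits of coarse classes
  let r : Setoid F :=
    { r := fun A B => ∃ (g : G) (n : ℕ), HausdorffDistLE Γ n (g • (A : Set G)) B
      iseqv :=
        { refl := fun A => ⟨1, 0, by simpa using HausdorffDistLE.refl (A : Set G)⟩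
          symm := by
            rintro A B ⟨g, n, h⟩
            exact ⟨g⁻¹, n, by simpa using (h.smul hS g⁻¹).symm⟩
          trans := by
            rintro A B C ⟨g, m, h⟩ ⟨g', n, h'⟩
            exact ⟨g' * g, m + n, by simpa [mul_smul] using (h.smul hS g').trans hc h'⟩ } }
  let rep : F → F := fun A => Quotient.out (Quotient.mk r A)
  have rep_rel : ∀ A, r (rep A) A := fun A => Quotient.mk_out A
  have rep_eq : ∀ {A B}, r A B → rep A = rep B := fun h => by
    simp only [rep, Quotient.sound h]
  have : Finite F := hfin.to_subtype
  let P : F → Subgroup G := fun A => coarseStabilizer hS (rep A : Set G)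
  have hP : ∀ A : F, ∃ N, HausdorffDistLE Γ N (rep A : Set G) (P A) := fun A =>
    exists_hausdorffDistLE_coarseStabilizer hS (rep A).2.1 (hne _ (rep A).2.1) hinv hfin
      (hbdd _ (rep A).2.1)
  obtain ⟨N, hN⟩ := exists_bound_of_finite (Set.finite_univ (α := F))
    (fun A n => HausdorffDistLE Γ n (rep A : Set G) (P A)) (fun A m n hmn h => h.mono hmn)
    (fun A _ => hP A)
  obtain ⟨N', hN'⟩ := exists_bound_of_finite (Set.finite_univ (α := F))
    (fun A n => ∃ g : G, HausdorffDistLE Γ n (g • (rep A : Set G)) A)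
    (fun A m n hmn h => h.imp fun g hg => hg.mono hmn)
    (fun A _ => by
      obtain ⟨g, n, h⟩ := rep_rel A
      exact ⟨n, g, h⟩)
  refine ⟨Set.range P, Set.finite_range P, ⟨N + N' + M, ?_, ?_⟩, ?_⟩
  · intro A hA
    obtain ⟨x, hx⟩ := hne A hA
    obtain ⟨A', hA', hxA'⟩ := hinv A hA x⁻¹
    obtain ⟨a, ha, h1a⟩ := hxA'.1 1 ⟨x, hx, by simp⟩
    have hF' : A' ∈ F := ⟨hA', a, ha, h1a⟩
    obtain ⟨g, hg⟩ := hN' ⟨A', hF'⟩ trivial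
    refine ⟨(x * g) • (P ⟨A', hF'⟩ : Set G), ⟨x * g, _, ⟨_, rfl⟩, rfl⟩, ?_⟩
    have h1 := ((hN ⟨A', hF'⟩ trivial).symm.smul hS (x * g))
    have h2 := hg.smul hS x
    have h3 := hxA'.symm.smul hS x
    rw [smul_smul] at h2
    rw [smul_inv_smul] at h3
    exact (h1.trans hc h2).trans hc h3
  · rintro _ ⟨g, _, ⟨A, rfl⟩, rfl⟩
    obtain ⟨A', hA', h⟩ := hinv _ (rep A).2.1 g
    refine ⟨A', hA', ?_⟩
    exact (((hN A trivial).symm.smul hS g).trans hc h).mono (by omega)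
  · rintro _ ⟨g, _, ⟨A, rfl⟩, rfl⟩ _ ⟨g', _, ⟨A', rfl⟩, rfl⟩ n h
    have h1 := (((hN A trivial).smul hS g).trans hc h).trans hc ((hN A' trivial).symm.smul hS g')
    have h2 := h1.smul hS g'⁻¹
    rw [inv_smul_smul, smul_smul] at h2
    have hrel : r (rep A) (rep A') := ⟨_, _, h2⟩
    have hAA' : rep A = rep A' := by
      have := rep_eq (r.iseqv.trans (r.iseqv.symm (rep_rel A)) (r.iseqv.trans hrel (rep_rel A')))
      exact this
    have hmem : g'⁻¹ * g ∈ P A' := by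
      rw [hAA'] at h2
      exact ⟨_, h2⟩
    have hPP : P A = P A' := by simp only [P, hAA']
    rw [hPP]
    ext z
    simp only [Set.mem_smul_set_iff_inv_smul_mem, smul_eq_mul, SetLike.mem_coe]
    rw [show g'⁻¹ * z = (g'⁻¹ * g) * (g⁻¹ * z) by group]
    exact ((P A').mul_mem_cancel_left hmem).symm

end CoarseStabilizer

/-! ### Quasi-isometries with natural constants -/

/-- A quasi-isometry of graphs with a single natural number as its constant. -/
structure IsNatQuasiIsometry {V W : Type*} (Γ : SimpleGraph V) (Δ : SimpleGraph W) (K : ℕ)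
    (q : V → W) : Prop where
  dist_map_le : ∀ x y, Δ.dist (q x) (q y) ≤ K * Γ.dist x y + K
  dist_le : ∀ x y, Γ.dist x y ≤ K * Δ.dist (q x) (q y) + K
  exists_dist_le : ∀ w, ∃ v, Δ.dist (q v) w ≤ K

section NatQuasiIsometry

variable {V W U : Type*} {Γ : SimpleGraph V} {Δ : SimpleGraph W} {Λ : SimpleGraph U}

theorem IsQuasiIsometry.exists_isNatQuasiIsometry {q : V → W} (h : IsQuasiIsometry Γ Δ q) :
    ∃ K, IsNatQuasiIsometry Γ Δ K q := by
  obtain ⟨L, C, hL, hC, hd, hs⟩ := h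
  have hLK := Nat.le_ceil L
  have hCK := Nat.le_ceil C
  have hLCK := Nat.le_ceil (L * C)
  have h1 : (0 : ℝ) ≤ ⌈L⌉₊ := Nat.cast_nonneg _
  have h2 : (0 : ℝ) ≤ ⌈C⌉₊ := Nat.cast_nonneg _
  have h3 : (0 : ℝ) ≤ ⌈L * C⌉₊ := Nat.cast_nonneg _
  set K : ℕ := ⌈L⌉₊ + ⌈C⌉₊ + ⌈L * C⌉₊ with hK
  have hKr : (K : ℝ) = ⌈L⌉₊ + ⌈C⌉₊ + ⌈L * C⌉₊ := by rw [hK]; push_cast; rfl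
  refine ⟨K, fun x y => ?_, fun x y => ?_, fun w => ?_⟩
  · have h := (hd x y).2
    have h5 : L * Γ.dist x y ≤ K * Γ.dist x y :=
      mul_le_mul_of_nonneg_right (by linarith) (Nat.cast_nonneg _)
    have : (Δ.dist (q x) (q y) : ℝ) ≤ K * Γ.dist x y + K := by linarith
    exact_mod_cast this
  · have h := (hd x y).1
    have hL0 : 0 < L := by linarith
    have h4 : (Γ.dist x y : ℝ) ≤ (Δ.dist (q x) (q y) + C) * L := by
      rw [← div_le_iff₀ hL0]; linarith
    have h5 : L * Δ.dist (q x) (q y) ≤ K * Δ.dist (q x) (q y) :=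
      mul_le_mul_of_nonneg_right (by linarith) (Nat.cast_nonneg _)
    have : (Γ.dist x y : ℝ) ≤ K * Δ.dist (q x) (q y) + K := by nlinarith
    exact_mod_cast this
  · obtain ⟨v, hv⟩ := hs w
    have : (Δ.dist (q v) w : ℝ) ≤ K := by linarith
    exact ⟨v, by exact_mod_cast this⟩

theorem IsNatQuasiIsometry.isQuasiIsometryWith {q : V → W} {K : ℕ}
    (h : IsNatQuasiIsometry Γ Δ K q) :
    IsQuasiIsometryWith Γ Δ (K + 1 : ℕ) (K + 1 : ℕ) q := by
  refine ⟨by push_cast; linarith [(Nat.cast_nonneg K : (0 : ℝ) ≤ K)], Nat.cast_nonneg _,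
    fun x y => ⟨?_, ?_⟩, fun w => ?_⟩
  · have h1 := h.dist_le x y
    have h2 : Γ.dist x y ≤ (Δ.dist (q x) (q y) + (K + 1)) * (K + 1) := by nlinarith
    have h3 : (Γ.dist x y : ℝ) ≤ (Δ.dist (q x) (q y) + (K + 1 : ℕ)) * (K + 1 : ℕ) := by
      exact_mod_cast h2
    rw [← div_le_iff₀ (by positivity)] at h3
    linarith
  · have h1 := h.dist_map_le x y
    have h2 : Δ.dist (q x) (q y) ≤ (K + 1) * Γ.dist x y + (K + 1) := by nlinarith
    exact_mod_cast h2
  · obtain ⟨v, hv⟩ := h.exists_dist_le w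
    exact ⟨v, by exact_mod_cast hv.trans (Nat.le_succ K)⟩

theorem IsNatQuasiIsometry.comp (hΛ : Λ.Connected) {f : V → W} {g : W → U} {K K' : ℕ}
    (hg : IsNatQuasiIsometry Δ Λ K' g) (hf : IsNatQuasiIsometry Γ Δ K f) :
    IsNatQuasiIsometry Γ Λ (K * K' + K + 2 * K') (g ∘ f) := by
  refine ⟨fun x y => ?_, fun x y => ?_, fun w => ?_⟩
  · have h1 := Nat.mul_le_mul_left K' (hf.dist_map_le x y)
    have h2 := hg.dist_map_le (f x) (f y)
    simp only [Function.comp_apply]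
    nlinarith
  · have h1 := hf.dist_le x y
    have h2 := Nat.mul_le_mul_left K (hg.dist_le (f x) (f y))
    simp only [Function.comp_apply]
    nlinarith
  · obtain ⟨y, hy⟩ := hg.exists_dist_le w
    obtain ⟨x, hx⟩ := hf.exists_dist_le y
    refine ⟨x, ?_⟩
    have h1 := hg.dist_map_le (f x) y
    have h2 := Nat.mul_le_mul_left K' hx
    have h3 := hΛ.dist_triangle (u := g (f x)) (v := g y) (w := w)
    simp only [Function.comp_apply]
    nlinarith

theorem IsNatQuasiIsometry.of_rightInverse (hΔ : Δ.Connected) {q : V → W} {K : ℕ}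
    (hq : IsNatQuasiIsometry Γ Δ K q) {r : W → V} (hr : ∀ w, Δ.dist (q (r w)) w ≤ K) :
    IsNatQuasiIsometry Δ Γ (2 * (K * K) + 3 * K) r := by
  refine ⟨fun u v => ?_, fun u v => ?_, fun x => ⟨q x, ?_⟩⟩
  · have h1 := hq.dist_le (r u) (r v)
    have h2 := hΔ.dist_triangle (u := q (r u)) (v := u) (w := q (r v))
    have h3 := hΔ.dist_triangle (u := u) (v := v) (w := q (r v))
    have h4 := Δ.dist_comm (u := v) (v := q (r v))
    have h5 : Δ.dist (q (r u)) (q (r v)) ≤ Δ.dist u v + 2 * K := by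
      have := hr u
      have := hr v
      omega
    have h6 := Nat.mul_le_mul_left K h5
    nlinarith
  · have h1 := hq.dist_map_le (r u) (r v)
    have h2 := hΔ.dist_triangle (u := u) (v := q (r u)) (w := v)
    have h3 := hΔ.dist_triangle (u := q (r u)) (v := q (r v)) (w := v)
    have h4 := Δ.dist_comm (u := u) (v := q (r u))
    have h5 : Δ.dist u v ≤ Δ.dist (q (r u)) (q (r v)) + 2 * K := by
      have := hr u
      have := hr v
      omega
    nlinarith
  · have h1 := hq.dist_le (r (q x)) x
    have h2 := Nat.mul_le_mul_left K (hr (q x))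
    nlinarith

end NatQuasiIsometry

theorem isNatQuasiIsometry_mul_left {H : Type*} [Group H] {S : Set H}
    (hS : Subgroup.closure S = ⊤) (g : H) :
    IsNatQuasiIsometry (SimpleGraph.mulCayley S) (SimpleGraph.mulCayley S) 1 (g * ·) := by
  refine ⟨fun x y => ?_, fun x y => ?_, fun w => ⟨g⁻¹ * w, by simp⟩⟩ <;>
  · rw [dist_mulCayley_mul_left hS]
    omega

/-! ### Cosets at finite Hausdorff distance -/

section Commensurator

variable {H : Type*} [Group H]

theorem relIndex_ne_zero_of_finite_cover {A B : Subgroup H} {F : Set H} (hF : F.Finite)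
    (h : ∀ a ∈ A, ∃ b ∈ F, a * b ∈ B) : B.relIndex A ≠ 0 := by
  choose! β hβF hβ using h
  have : Finite F := hF.to_subtype
  have hinj : Function.Injective (fun c : A ⧸ B.subgroupOf A =>
      (⟨β (c.out⁻¹ : A), hβF _ (c.out⁻¹ : A).2⟩ : F)) := by
    intro c d hcd
    have hcd' : β (c.out⁻¹ : A) = β (d.out⁻¹ : A) := congrArg Subtype.val hcd
    have h1 := hβ _ (c.out⁻¹ : A).2
    have h2 := hβ _ (d.out⁻¹ : A).2
    rw [hcd'] at h1
    have h3 := B.mul_mem h1 (B.inv_mem h2)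
    rw [← c.out_eq', ← d.out_eq', QuotientGroup.eq, Subgroup.mem_subgroupOf]
    simpa using h3
  have : Finite (A ⧸ B.subgroupOf A) := Finite.of_injective _ hinj
  exact Subgroup.index_ne_zero_of_finite

theorem mem_commensurator_of_hausdorffDistLE {T : Set H} (hfin : T.Finite)
    (hT : Subgroup.closure T = ⊤) {Q : Subgroup H} {c : H} {n : ℕ}
    (h : HausdorffDistLE (SimpleGraph.mulCayley T) n (c • (Q : Set H)) Q) :
    c ∈ Subgroup.Commensurable.commensurator Q := by
  have hball := finite_ball_mulCayley hfin hT 1 n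
  rw [Subgroup.Commensurable.commensurator_mem_iff]
  constructor
  · refine relIndex_ne_zero_of_finite_cover (hball.image (· * c⁻¹)) fun a ha => ?_
    obtain ⟨_, ⟨b, hb, rfl⟩, hab⟩ := h.2 a ha
    rw [SimpleGraph.dist_comm, ← dist_mulCayley_one hT] at hab
    refine ⟨_, ⟨_, hab, rfl⟩, ?_⟩
    rw [Subgroup.mem_pointwise_smul_iff_inv_smul_mem]
    simpa [ConjAct.smul_def, mul_assoc] using hb
  · refine relIndex_ne_zero_of_finite_cover (hball.image (c * ·)) fun a ha => ?_
    rw [Subgroup.mem_pointwise_smul_iff_inv_smul_mem] at ha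
    obtain ⟨b, hb, hab⟩ := h.1 _ (Set.smul_mem_smul_set (a := c) ha)
    rw [← dist_mulCayley_one hT] at hab
    refine ⟨_, ⟨_, hab, rfl⟩, ?_⟩
    simpa [ConjAct.smul_def, mul_assoc] using hb

/-- If each member of a finite collection has finite index in its commensurator, then only finitely
many cosets are at finite Hausdorff distance from a given set. -/
theorem finite_cosets_hausdorffDistLE {T : Set H} (hfin : T.Finite)
    (hT : Subgroup.closure T = ⊤) {Qs : Set (Subgroup H)} (hQs : Qs.Finite)
    (hcomm : ∀ Q ∈ Qs, Q.IsFiniteRelIndex (Subgroup.Commensurable.commensurator Q)) (B : Set H) :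
    {B' ∈ cosetsOf Qs | ∃ n, HausdorffDistLE (SimpleGraph.mulCayley T) n B B'}.Finite := by
  have hc := connected_mulCayley hT
  have key : ∀ Q ∈ Qs, {B' | (∃ k : H, B' = k • (Q : Set H)) ∧
      ∃ n, HausdorffDistLE (SimpleGraph.mulCayley T) n B B'}.Finite := by
    intro Q hQ
    rcases Set.eq_empty_or_nonempty {B' | (∃ k : H, B' = k • (Q : Set H)) ∧
      ∃ n, HausdorffDistLE (SimpleGraph.mulCayley T) n B B'} with h | ⟨_, ⟨k₀, rfl⟩, n₀, h₀⟩
    · rw [h]; exact Set.finite_empty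
    have := hcomm Q hQ
    refine (Set.finite_range (fun x : Subgroup.Commensurable.commensurator Q ⧸
      Q.subgroupOf (Subgroup.Commensurable.commensurator Q) =>
        k₀ • (x.out : H) • (Q : Set H))).subset ?_
    rintro _ ⟨⟨k, rfl⟩, n, h⟩
    have h1 := (h.symm.trans hc h₀).smul hT k₀⁻¹
    rw [inv_smul_smul, smul_smul] at h1
    have hmem := mem_commensurator_of_hausdorffDistLE hfin hT h1
    refine ⟨QuotientGroup.mk ⟨_, hmem⟩, ?_⟩
    have h2 := QuotientGroup.mk_out_eq_mul (Q.subgroupOf (Subgroup.Commensurable.commensurator Q))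
      ⟨k₀⁻¹ * k, hmem⟩
    obtain ⟨z, hz⟩ := h2
    have hzQ : ((z : Subgroup.Commensurable.commensurator Q) : H) ∈ Q :=
      Subgroup.mem_subgroupOf.mp z.2
    simp only [hz, Subgroup.coe_mul, mul_smul, smul_coe_set hzQ, smul_inv_smul]
  refine (hQs.biUnion key).subset ?_
  rintro _ ⟨⟨k, Q, hQ, rfl⟩, hn⟩
  exact Set.mem_biUnion hQ ⟨⟨k, rfl⟩, hn⟩

theorem eq_smul_of_mem_coset {Q : Subgroup H} {h b : H} (hb : b ∈ h • (Q : Set H)) :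
    h • (Q : Set H) = b • (Q : Set H) := by
  obtain ⟨z, hz, rfl⟩ := hb
  change h • (Q : Set H) = (h * z) • (Q : Set H)
  rw [mul_smul, smul_coe_set hz]

theorem finite_cosets_of_finite {Qs : Set (Subgroup H)} (hQs : Qs.Finite) {F : Set H}
    (hF : F.Finite) : {B ∈ cosetsOf Qs | ∃ b ∈ B, b ∈ F}.Finite := by
  refine (hQs.biUnion fun Q _ => hF.image (fun b => b • (Q : Set H))).subset ?_
  rintro _ ⟨⟨h, Q, hQ, rfl⟩, b, hb, hbF⟩
  exact Set.mem_biUnion hQ ⟨b, hbF, (eq_smul_of_mem_coset hb).symm⟩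

end Commensurator

/-! ### The subgroups induced by a qi-characteristic collection -/

section Pairs

variable {G H : Type*} [Group G] [Group H]

/-- The maps `q ∘ (g * ·) ∘ r` of `H` are quasi-isometries with constants independent of `g`, so
they map each coset of a qi-characteristic collection to within a bounded Hausdorff distance of a
coset. -/
theorem exists_hausdorffDistLE_image_smul {S₀ : Set G} (hS₀ : Subgroup.closure S₀ = ⊤)
    {T₀ : Set H} (hT₀ : Subgroup.closure T₀ = ⊤) {Qs : Set (Subgroup H)}
    (hQs : IsQICharacteristic T₀ Qs) {q : G → H} {r : H → G} {K K' : ℕ}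
    (hq : IsNatQuasiIsometry (SimpleGraph.mulCayley S₀) (SimpleGraph.mulCayley T₀) K q)
    (hr : IsNatQuasiIsometry (SimpleGraph.mulCayley T₀) (SimpleGraph.mulCayley S₀) K' r) :
    ∃ M : ℕ, ∀ B ∈ cosetsOf Qs, ∀ g : G, ∃ B' ∈ cosetsOf Qs,
      HausdorffDistLE (SimpleGraph.mulCayley T₀) M (q '' (g • (r '' B))) B' := by
  obtain ⟨K'', hK''⟩ : ∃ K'', ∀ g : G, IsNatQuasiIsometry (SimpleGraph.mulCayley T₀)
      (SimpleGraph.mulCayley T₀) K'' (q ∘ ((g * ·) ∘ r)) :=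
    ⟨_, fun g => hq.comp (connected_mulCayley hT₀)
      ((isNatQuasiIsometry_mul_left hS₀ g).comp (connected_mulCayley hS₀) hr)⟩
  obtain ⟨M, -, hM⟩ := hQs.2.2 (K'' + 1 : ℕ) (K'' + 1 : ℕ)
    (by exact_mod_cast Nat.le_add_left 1 K'') (Nat.cast_nonneg _)
  refine ⟨⌈M⌉₊, fun B hB g => ?_⟩
  obtain ⟨B', hB', h⟩ := (hM _ (hK'' g).isQuasiIsometryWith).2.1 B hB
  refine ⟨B', hB', ?_⟩
  have := h.exists_hausdorffDistLE
  rwa [Set.image_comp, Set.image_comp, show (fun x => g * x) '' (r '' B) = g • (r '' B) from rfl]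
    at this

/-- A qi-characteristic collection `Qs` of `H` can be pulled back along a quasi-isometry `q` to a
collection `Ps` of subgroups of `G` whose distinct cosets are at infinite Hausdorff distance. -/
theorem exists_subgroups_of_isQICharacteristic {S₀ : Set G} (hS₀ : Subgroup.closure S₀ = ⊤)
    {T₀ : Set H} (hT₀_finite : T₀.Finite) (hT₀ : Subgroup.closure T₀ = ⊤)
    {Qs : Set (Subgroup H)} (hQs : IsQICharacteristic T₀ Qs) {q : G → H} {K : ℕ}
    (hq : IsNatQuasiIsometry (SimpleGraph.mulCayley S₀) (SimpleGraph.mulCayley T₀) K q) :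
    ∃ Ps : Set (Subgroup G), Ps.Finite ∧
      (∃ N, (∀ A ∈ cosetsOf Ps, ∃ B ∈ cosetsOf Qs,
          HausdorffDistLE (SimpleGraph.mulCayley T₀) N (q '' A) B) ∧
        ∀ B ∈ cosetsOf Qs, ∃ A ∈ cosetsOf Ps,
          HausdorffDistLE (SimpleGraph.mulCayley T₀) N (q '' A) B) ∧
      ∀ A ∈ cosetsOf Ps, ∀ A' ∈ cosetsOf Ps, ∀ n,
        HausdorffDistLE (SimpleGraph.mulCayley S₀) n A A' → A = A' := by
  have hcH := connected_mulCayley hT₀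
  choose r hr using hq.exists_dist_le
  have hrq := hq.of_rightInverse hcH hr
  obtain ⟨M, hM⟩ := exists_hausdorffDistLE_image_smul hS₀ hT₀ hQs hq hrq
  have hqr : ∀ B : Set H, HausdorffDistLE (SimpleGraph.mulCayley T₀) K (q '' (r '' B)) B := by
    intro B
    constructor
    · rintro _ ⟨_, ⟨b, hb, rfl⟩, rfl⟩
      exact ⟨b, hb, hr b⟩
    · intro b hb
      exact ⟨_, ⟨_, ⟨b, hb, rfl⟩, rfl⟩, hr b⟩
  obtain ⟨Ps, hPs, ⟨N, hN₁, hN₂⟩, hsep⟩ := exists_subgroups_of_coarselyInvariant hS₀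
    (𝒜 := (fun B => r '' B) '' cosetsOf Qs) (M := K * (M + K) + K)
    (by
      rintro _ ⟨_, ⟨h, Q, -, rfl⟩, rfl⟩
      exact ⟨r h, h, ⟨1, Q.one_mem, by simp⟩, rfl⟩)
    (by
      rintro _ ⟨B, hB, rfl⟩ g
      obtain ⟨B', hB', h⟩ := hM B hB g
      exact ⟨_, ⟨B', hB', rfl⟩, (h.trans hcH (hqr B').symm).of_image hq.dist_le⟩)
    (by
      have hball := finite_ball_mulCayley hT₀_finite hT₀ (q 1) (K * (K * (M + K) + K) + K + K)
      refine ((finite_cosets_of_finite hQs.1 hball).image (fun B => r '' B)).subset ?_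
      rintro _ ⟨⟨B, hB, rfl⟩, _, ⟨b, hb, rfl⟩, hd⟩
      refine ⟨B, ⟨hB, b, hb, ?_⟩, rfl⟩
      exact hcH.dist_triangle.trans (add_le_add
        ((hq.dist_map_le 1 (r b)).trans (by gcongr)) (hr b)))
    (by
      rintro _ ⟨B, hB, rfl⟩
      have hfin := finite_cosets_hausdorffDistLE hT₀_finite hT₀ hQs.1 hQs.2.1 B
      obtain ⟨D, hD⟩ := exists_bound_of_finite hfin
        (fun B' n => HausdorffDistLE (SimpleGraph.mulCayley T₀) n B B')
        (fun B' m n hmn h => h.mono hmn) (fun B' hB' => hB'.2)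
      refine ⟨(2 * (K * K) + 3 * K) * D + (2 * (K * K) + 3 * K), ?_⟩
      rintro _ ⟨B', hB', rfl⟩ ⟨n, hn⟩
      have h1 := ((hqr B).symm.trans hcH (hn.image hq.dist_map_le)).trans hcH (hqr B')
      exact (hD B' ⟨hB', _, h1⟩).image hrq.dist_map_le)
  refine ⟨Ps, hPs, ⟨K * N + K + K, fun A hA => ?_, fun B hB => ?_⟩, hsep⟩
  · obtain ⟨_, ⟨B, hB, rfl⟩, h⟩ := hN₂ A hA
    exact ⟨B, hB, (h.image hq.dist_map_le).trans hcH (hqr B)⟩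
  · obtain ⟨A, hA, h⟩ := hN₁ _ ⟨B, hB, rfl⟩
    exact ⟨A, hA, (h.image hq.dist_map_le).trans hcH (hqr B)⟩

end Pairs

/-! ### Coned-off Cayley graphs -/

section ConedOff

variable {G H : Type*} [Group G] [Group H]

theorem mem_smul_self (g : G) (P : Subgroup G) : g ∈ g • (P : Set G) :=
  ⟨1, P.one_mem, by simp⟩

theorem mem_smul_of_inv_mul_mem {x y : G} {P : Subgroup G} (h : x⁻¹ * y ∈ P) :
    y ∈ x • (P : Set G) :=
  ⟨x⁻¹ * y, h, by simp⟩

theorem closure_union_eq_top {S : Set G} (hS : Subgroup.closure S = ⊤) (X : Set G) :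
    Subgroup.closure (S ∪ X) = ⊤ :=
  top_le_iff.mp (hS ▸ Subgroup.closure_mono Set.subset_union_left)

theorem adj_or_exists_coset_of_adj_union {S : Set G} {Ps : Set (Subgroup G)} {x y : G}
    (h : (SimpleGraph.mulCayley (S ∪ ⋃ P ∈ Ps, (P : Set G))).Adj x y) :
    (SimpleGraph.mulCayley S).Adj x y ∨ ∃ A ∈ cosetsOf Ps, x ∈ A ∧ y ∈ A := by
  rw [SimpleGraph.mulCayley_union, SimpleGraph.sup_adj] at h
  refine h.imp_right fun h => ?_
  obtain ⟨P, hP, hxy⟩ : ∃ P ∈ Ps, x⁻¹ * y ∈ P := by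
    obtain ⟨-, h | h⟩ := (SimpleGraph.mulCayley_adj _ _ _).mp h
    · simpa using h
    · obtain ⟨P, hP, h⟩ : ∃ P ∈ Ps, y⁻¹ * x ∈ P := by simpa using h
      exact ⟨P, hP, by simpa using P.inv_mem h⟩
  exact ⟨_, ⟨x, P, hP, rfl⟩, mem_smul_self x P, mem_smul_of_inv_mul_mem hxy⟩

theorem inv_mul_mem_of_mem_smul {P : Subgroup G} {g x y : G} (hx : x ∈ g • (P : Set G))
    (hy : y ∈ g • (P : Set G)) : x⁻¹ * y ∈ P := by
  obtain ⟨a, ha, rfl⟩ := hx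
  obtain ⟨b, hb, rfl⟩ := hy
  simpa [mul_assoc] using P.mul_mem (P.inv_mem ha) hb

theorem dist_le_one_of_mem_coset {S : Set G} {Ps : Set (Subgroup G)} {A : Set G}
    (hA : A ∈ cosetsOf Ps) {x y : G} (hx : x ∈ A) (hy : y ∈ A) :
    (SimpleGraph.mulCayley (S ∪ ⋃ P ∈ Ps, (P : Set G))).dist x y ≤ 1 := by
  obtain ⟨g, P, hP, rfl⟩ := hA
  by_cases hxy : x = y
  · simp [hxy]
  refine (SimpleGraph.dist_eq_one_iff_adj.mpr ((SimpleGraph.mulCayley_adj _ _ _).mpr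
    ⟨hxy, Or.inl (Or.inr ?_)⟩)).le
  simpa using ⟨P, hP, inv_mul_mem_of_mem_smul hx hy⟩

/-- The word metric of a finite generating set dominates every other word metric. -/
theorem exists_dist_le_mul_dist {S₀ S : Set G} (hfin : S₀.Finite)
    (hS₀ : Subgroup.closure S₀ = ⊤) (hS : Subgroup.closure S = ⊤) :
    ∃ c : ℕ, ∀ x y, (SimpleGraph.mulCayley S).dist x y ≤
      c * (SimpleGraph.mulCayley S₀).dist x y := by
  obtain ⟨c, hc⟩ := (hfin.image fun s => (SimpleGraph.mulCayley S).dist 1 s).bddAbove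
  refine ⟨c, fun x y => dist_map_le (f := id) (connected_mulCayley hS₀) (connected_mulCayley hS)
    (fun x y hxy => ?_) x y⟩
  obtain ⟨-, h | h⟩ := (SimpleGraph.mulCayley_adj _ _ _).mp hxy
  · rw [id, id, ← dist_mulCayley_one hS]
    exact hc ⟨_, h, rfl⟩
  · rw [id, id, SimpleGraph.dist_comm, ← dist_mulCayley_one hS]
    exact hc ⟨_, h, rfl⟩

/-- A map which is coarsely Lipschitz for `S` and `T` and sends each coset of `Ps` near a coset of
`Qs` is Lipschitz for the coned-off Cayley graphs. -/
theorem exists_dist_map_le_conedOff {S : Set G} (hS : Subgroup.closure S = ⊤) {T : Set H}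
    (hT : Subgroup.closure T = ⊤) {Ps : Set (Subgroup G)} {Qs : Set (Subgroup H)} {f : G → H}
    {K N : ℕ} (hf : ∀ x y, (SimpleGraph.mulCayley T).dist (f x) (f y) ≤
      K * (SimpleGraph.mulCayley S).dist x y + K)
    (hA : ∀ A ∈ cosetsOf Ps, ∃ B ∈ cosetsOf Qs, ∀ a ∈ A, ∃ b ∈ B,
      (SimpleGraph.mulCayley T).dist (f a) b ≤ N) :
    ∃ K' : ℕ, ∀ x y, (SimpleGraph.mulCayley (T ∪ ⋃ Q ∈ Qs, (Q : Set H))).dist (f x) (f y) ≤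
      K' * (SimpleGraph.mulCayley (S ∪ ⋃ P ∈ Ps, (P : Set G))).dist x y := by
  have hΓ := connected_mulCayley (closure_union_eq_top hS (⋃ P ∈ Ps, (P : Set G)))
  have hΔ := connected_mulCayley (closure_union_eq_top hT (⋃ Q ∈ Qs, (Q : Set H)))
  have hle : ∀ u v, (SimpleGraph.mulCayley (T ∪ ⋃ Q ∈ Qs, (Q : Set H))).dist u v ≤
      (SimpleGraph.mulCayley T).dist u v :=
    dist_le_of_le (connected_mulCayley hT) (SimpleGraph.mulCayley_mono Set.subset_union_left)
  refine ⟨2 * K + 2 * N + 1, dist_map_le hΓ hΔ fun x y hxy => ?_⟩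
  rcases adj_or_exists_coset_of_adj_union hxy with h | ⟨A, hA', hx, hy⟩
  · have h1 := hf x y
    rw [SimpleGraph.dist_eq_one_iff_adj.mpr h] at h1
    have h2 := hle (f x) (f y)
    omega
  · obtain ⟨B, hB, hAB⟩ := hA A hA'
    obtain ⟨b, hb, hxb⟩ := hAB x hx
    obtain ⟨b', hb', hyb⟩ := hAB y hy
    rw [SimpleGraph.dist_comm] at hyb
    have h1 := hle (f x) b
    have h2 := hle b' (f y)
    have h3 := dist_le_one_of_mem_coset (S := T) hB hb hb'
    have t1 := hΔ.dist_triangle (u := f x) (v := b) (w := f y)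
    have t2 := hΔ.dist_triangle (u := b) (v := b') (w := f y)
    omega

/-- Hyperbolicity of the coned-off Cayley graphs passes from `H` to `G`, since `q` and a
quasi-inverse of `q` are both Lipschitz for these graphs. -/
theorem isHyperbolicGraph_conedOff {S₀ : Set G} (hS₀_finite : S₀.Finite)
    (hS₀ : Subgroup.closure S₀ = ⊤) {T₀ : Set H} (hT₀_finite : T₀.Finite)
    (hT₀ : Subgroup.closure T₀ = ⊤) {S : Set G} (hS : Subgroup.closure S = ⊤) {T : Set H}
    (hT : Subgroup.closure T = ⊤) {Ps : Set (Subgroup G)} {Qs : Set (Subgroup H)} {q : G → H}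
    {K K' N : ℕ}
    (hq : IsNatQuasiIsometry (SimpleGraph.mulCayley S₀) (SimpleGraph.mulCayley T₀) K q)
    (hqS : IsNatQuasiIsometry (SimpleGraph.mulCayley S) (SimpleGraph.mulCayley T) K' q)
    (hPQ : ∀ A ∈ cosetsOf Ps, ∃ B ∈ cosetsOf Qs,
      HausdorffDistLE (SimpleGraph.mulCayley T₀) N (q '' A) B)
    (hQP : ∀ B ∈ cosetsOf Qs, ∃ A ∈ cosetsOf Ps,
      HausdorffDistLE (SimpleGraph.mulCayley T₀) N (q '' A) B)
    (hhyp : IsHyperbolicGraph (SimpleGraph.mulCayley (T ∪ ⋃ Q ∈ Qs, (Q : Set H)))) :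
    IsHyperbolicGraph (SimpleGraph.mulCayley (S ∪ ⋃ P ∈ Ps, (P : Set G))) := by
  have hcT₀ := connected_mulCayley hT₀
  have hcT := connected_mulCayley hT
  have hΓ := connected_mulCayley (closure_union_eq_top hS (⋃ P ∈ Ps, (P : Set G)))
  have hle : ∀ x y, (SimpleGraph.mulCayley (S ∪ ⋃ P ∈ Ps, (P : Set G))).dist x y ≤
      (SimpleGraph.mulCayley S).dist x y :=
    dist_le_of_le (connected_mulCayley hS) (SimpleGraph.mulCayley_mono Set.subset_union_left)
  obtain ⟨c, hc⟩ := exists_dist_le_mul_dist hT₀_finite hT₀ hT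
  obtain ⟨c', hc'⟩ := exists_dist_le_mul_dist hS₀_finite hS₀ hS
  choose r hr using hq.exists_dist_le
  -- `r` is also a quasi-inverse of `q` for the generating sets `S` and `T`
  have hqS' : IsNatQuasiIsometry (SimpleGraph.mulCayley S) (SimpleGraph.mulCayley T)
      (K' + c * K) q :=
    ⟨fun x y => (hqS.dist_map_le x y).trans (by gcongr <;> omega),
      fun x y => (hqS.dist_le x y).trans (by gcongr <;> omega),
      fun w => ⟨r w, (hc _ _).trans ((Nat.mul_le_mul_left c (hr w)).trans (by omega))⟩⟩
  have hrT : ∀ w, (SimpleGraph.mulCayley T).dist (q (r w)) w ≤ K' + c * K := fun w =>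
    (hc _ _).trans ((Nat.mul_le_mul_left c (hr w)).trans (by omega))
  have hrS := hqS'.of_rightInverse hcT hrT
  obtain ⟨L, hL⟩ := exists_dist_map_le_conedOff (N := c * N) hS hT hqS.dist_map_le
    (fun A hA => by
      obtain ⟨B, hB, h⟩ := hPQ A hA
      refine ⟨B, hB, fun a ha => ?_⟩
      obtain ⟨b, hb, hab⟩ := h.1 _ ⟨a, ha, rfl⟩
      exact ⟨b, hb, (hc _ _).trans (Nat.mul_le_mul_left c hab)⟩)
  obtain ⟨L', hL'⟩ := exists_dist_map_le_conedOff (N := c' * (K * (K + N) + K)) hT hS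
    hrS.dist_map_le (fun B hB => by
      obtain ⟨A, hA, h⟩ := hQP B hB
      refine ⟨A, hA, fun b hb => ?_⟩
      obtain ⟨_, ⟨a, ha, rfl⟩, hab⟩ := h.2 b hb
      refine ⟨a, ha, (hc' _ _).trans (Nat.mul_le_mul_left c' ((hq.dist_le _ _).trans ?_))⟩
      rw [SimpleGraph.dist_comm] at hab
      gcongr
      exact hcT₀.dist_triangle.trans (add_le_add (hr b) hab))
  -- every point is at bounded distance from its image under `r ∘ q`
  obtain ⟨E, hE⟩ : ∃ E, ∀ x,
      (SimpleGraph.mulCayley (S ∪ ⋃ P ∈ Ps, (P : Set G))).dist (r (q x)) x ≤ E :=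
    ⟨K' * (K' + c * K) + K', fun x => (hle _ _).trans ((hqS.dist_le _ _).trans (by
      gcongr
      exact hrT (q x)))⟩
  refine hhyp.of_quasiIsometricEmbedding hΓ q (L + L' + 2 * E) (fun x y => ?_) (fun x y => ?_)
  · have := hL x y
    nlinarith
  · have h1 := hL' (q x) (q y)
    have h2 := hE x
    have h3 := hE y
    rw [SimpleGraph.dist_comm] at h2
    have t1 := hΓ.dist_triangle (u := x) (v := r (q x)) (w := y)
    have t2 := hΓ.dist_triangle (u := r (q x)) (v := r (q y)) (w := y)
    nlinarith

/-! ### Relative metrics -/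

theorem eq_of_smul_coe_eq_coe {x : G} {P P' : Subgroup G}
    (h : x • (P' : Set G) = (P : Set G)) : P' = P ∧ x ∈ P := by
  have hx : x ∈ P := by
    rw [← SetLike.mem_coe, ← h]
    exact mem_smul_self x P'
  refine ⟨SetLike.coe_injective ?_, hx⟩
  rw [← smul_coe_set (P.inv_mem hx), ← h, inv_smul_smul]

theorem adj_or_exists_coset_of_adj_relativeGraph {S : Set G} {Ps : Set (Subgroup G)}
    {P : Subgroup G} {x y : G} (h : (relativeGraph Ps S P).Adj x y) :
    (SimpleGraph.mulCayley S).Adj x y ∨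
      ∃ A ∈ cosetsOf Ps, A ≠ (P : Set G) ∧ x ∈ A ∧ y ∈ A := by
  obtain ⟨hne, h | h | ⟨P', hP', hxy, hnot⟩⟩ := h
  · exact Or.inl ((SimpleGraph.mulCayley_adj _ _ _).mpr ⟨hne, Or.inl h⟩)
  · exact Or.inl ((SimpleGraph.mulCayley_adj _ _ _).mpr ⟨hne, Or.inr h⟩)
  · refine Or.inr ⟨_, ⟨x, P', hP', rfl⟩, fun heq => hnot ?_, mem_smul_self x P',
      mem_smul_of_inv_mul_mem hxy⟩
    obtain ⟨rfl, hx⟩ := eq_of_smul_coe_eq_coe heq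
    exact ⟨rfl, hx, by simpa using P'.mul_mem hx hxy⟩

theorem mulCayley_le_relativeGraph (S : Set G) (Ps : Set (Subgroup G)) (P : Subgroup G) :
    SimpleGraph.mulCayley S ≤ relativeGraph Ps S P := by
  intro x y h
  obtain ⟨hne, h | h⟩ := (SimpleGraph.mulCayley_adj _ _ _).mp h
  · exact ⟨hne, Or.inl h⟩
  · exact ⟨hne, Or.inr (Or.inl h)⟩

theorem edist_relativeGraph_le_dist {S : Set G} (hS : Subgroup.closure S = ⊤)
    (Ps : Set (Subgroup G)) (P : Subgroup G) (g x y : G) :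
    (relativeGraph Ps S P).edist (g * x) (g * y) ≤ (SimpleGraph.mulCayley S).dist x y := by
  refine (SimpleGraph.edist_anti (mulCayley_le_relativeGraph S Ps P)).trans ?_
  rw [← ((connected_mulCayley hS) _ _).coe_dist_eq_edist, dist_mulCayley_mul_left hS]

theorem edist_relativeGraph_le_one {S : Set G} {Ps : Set (Subgroup G)} {P : Subgroup G}
    {g : G} {B : Set G} (hB : B ∈ cosetsOf Ps) (hne : B ≠ g • (P : Set G)) {x y : G}
    (hx : x ∈ B) (hy : y ∈ B) : (relativeGraph Ps S P).edist (g⁻¹ * x) (g⁻¹ * y) ≤ 1 := by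
  rw [SimpleGraph.edist_le_one_iff_adj_or_eq]
  by_cases hxy : x = y
  · exact Or.inr (by rw [hxy])
  obtain ⟨k, P', hP', rfl⟩ := hB
  refine Or.inl ⟨by simpa using hxy, Or.inr (Or.inr ⟨P', hP', ?_, ?_⟩)⟩
  · simpa [mul_assoc] using inv_mul_mem_of_mem_smul hx hy
  · rintro ⟨rfl, hxP, -⟩
    exact hne ((eq_smul_of_mem_coset hx).trans
      (eq_smul_of_mem_coset (mem_smul_of_inv_mul_mem hxP)).symm)

/-- The relative metrics of `Ps` are locally finite. An edge of the relative graph of `P` which is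
labelled by a subgroup lies in a coset other than `P`. This coset is at infinite Hausdorff distance
from `P`, so `q` maps it near a coset of `Qs` other than the one near `q '' P`. Hence a path in the
relative graph of `P` gives a path in a translate of a relative graph of `Qs`, of a proportional
length. -/
theorem finite_relativeGraph_ball {S₀ : Set G} (hS₀_finite : S₀.Finite)
    (hS₀ : Subgroup.closure S₀ = ⊤) {T₀ : Set H} (hT₀_finite : T₀.Finite)
    (hT₀ : Subgroup.closure T₀ = ⊤) {S : Set G} {T : Set H}
    (hT : Subgroup.closure T = ⊤) {Ps : Set (Subgroup G)} {Qs : Set (Subgroup H)} {q : G → H}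
    {K K' N : ℕ}
    (hq : IsNatQuasiIsometry (SimpleGraph.mulCayley S₀) (SimpleGraph.mulCayley T₀) K q)
    (hqS : IsNatQuasiIsometry (SimpleGraph.mulCayley S) (SimpleGraph.mulCayley T) K' q)
    (hPQ : ∀ A ∈ cosetsOf Ps, ∃ B ∈ cosetsOf Qs,
      HausdorffDistLE (SimpleGraph.mulCayley T₀) N (q '' A) B)
    (hsep : ∀ A ∈ cosetsOf Ps, ∀ A' ∈ cosetsOf Ps, ∀ n,
      HausdorffDistLE (SimpleGraph.mulCayley S₀) n A A' → A = A')
    (hQs : ∀ Q ∈ Qs, ∀ g ∈ Q, ∀ n : ℕ,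
      {h : H | h ∈ Q ∧ (relativeGraph Qs T Q).edist g h ≤ n}.Finite)
    {P : Subgroup G} (hP : P ∈ Ps) {g : G} (hg : g ∈ P) (n : ℕ) :
    {h : G | h ∈ P ∧ (relativeGraph Ps S P).edist g h ≤ n}.Finite := by
  have hcT₀ := connected_mulCayley hT₀
  obtain ⟨c, hc⟩ := exists_dist_le_mul_dist hT₀_finite hT₀ hT
  have hPc : (P : Set G) ∈ cosetsOf Ps := ⟨1, P, hP, by simp⟩
  obtain ⟨_, ⟨k, Q, hQ, rfl⟩, hB₀⟩ := hPQ _ hPc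
  -- points at `T₀`-distance at most `N` are close in the relative graph
  have near : ∀ u v, (SimpleGraph.mulCayley T₀).dist u v ≤ N →
      (relativeGraph Qs T Q).edist (k⁻¹ * u) (k⁻¹ * v) ≤ (c * N : ℕ) := fun u v huv =>
    (edist_relativeGraph_le_dist hT Qs Q _ _ _).trans
      (by exact_mod_cast (hc u v).trans (Nat.mul_le_mul_left c huv))
  have lip : ∀ x y, (relativeGraph Ps S P).Adj x y →
      (relativeGraph Qs T Q).edist (k⁻¹ * q x) (k⁻¹ * q y) ≤ (2 * K' + 2 * (c * N) + 1 : ℕ) := by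
    intro x y hxy
    rcases adj_or_exists_coset_of_adj_relativeGraph hxy with h | ⟨A, hA, hne, hx, hy⟩
    · have h1 := hqS.dist_map_le x y
      rw [SimpleGraph.dist_eq_one_iff_adj.mpr h] at h1
      refine (edist_relativeGraph_le_dist hT Qs Q _ _ _).trans ?_
      exact_mod_cast h1.trans (by omega)
    · obtain ⟨B, hB, hAB⟩ := hPQ A hA
      have hBne : B ≠ k • (Q : Set H) := by
        rintro rfl
        exact hne (hsep _ hA _ hPc _ ((hAB.trans hcT₀ hB₀.symm).of_image hq.dist_le))
      obtain ⟨b, hb, hxb⟩ := hAB.1 _ ⟨x, hx, rfl⟩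
      obtain ⟨b', hb', hyb⟩ := hAB.1 _ ⟨y, hy, rfl⟩
      rw [SimpleGraph.dist_comm] at hyb
      refine (SimpleGraph.edist_triangle (v := k⁻¹ * b)).trans ((add_le_add (near _ _ hxb)
        (SimpleGraph.edist_triangle (v := k⁻¹ * b'))).trans ((add_le_add le_rfl (add_le_add
          (edist_relativeGraph_le_one hB hBne hb hb') (near _ _ hyb))).trans ?_))
      exact_mod_cast (by omega : c * N + (1 + c * N) ≤ 2 * K' + 2 * (c * N) + 1)
  set L := 2 * K' + 2 * (c * N) + 1 with hL
  obtain ⟨_, ⟨z₀, hz₀, rfl⟩, hgz₀⟩ := hB₀.1 _ ⟨g, hg, rfl⟩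
  have hfin := hQs Q hQ z₀ hz₀ (c * N + (L * n + c * N))
  -- a ball of `H` has finite preimage under `q`
  have hpre : ∀ w, {x | (SimpleGraph.mulCayley T₀).dist (q x) w ≤ N}.Finite := by
    intro w
    rcases Set.eq_empty_or_nonempty {x | (SimpleGraph.mulCayley T₀).dist (q x) w ≤ N} with h | h
    · rw [h]; exact Set.finite_empty
    · obtain ⟨x₀, hx₀⟩ := h
      refine (finite_ball_mulCayley hS₀_finite hS₀ x₀ (K * (N + N) + K)).subset fun x hx => ?_
      have hx : (SimpleGraph.mulCayley T₀).dist (q x) w ≤ N := hx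
      rw [SimpleGraph.dist_comm] at hx
      refine (hq.dist_le x₀ x).trans ?_
      gcongr
      exact hcT₀.dist_triangle.trans (add_le_add hx₀ hx)
  refine (hfin.biUnion fun z _ => hpre (k * z)).subset ?_
  rintro x ⟨hx, hgx⟩
  obtain ⟨_, ⟨z, hz, rfl⟩, hxz⟩ := hB₀.1 _ ⟨x, hx, rfl⟩
  refine Set.mem_biUnion (x := z) ⟨hz, ?_⟩ hxz
  obtain ⟨p, hp⟩ := SimpleGraph.exists_walk_of_edist_ne_top
    (ne_top_of_le_ne_top (ENat.natCast_ne_top n) hgx)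
  rw [← hp] at hgx
  have hpn : p.length ≤ n := by exact_mod_cast hgx
  have h1 := edist_map_le_of_walk (f := fun x => k⁻¹ * q x) lip p
  have h2 := near _ _ hgz₀
  have h3 := near _ _ hxz
  rw [SimpleGraph.edist_comm] at h2
  simp only [smul_eq_mul, inv_mul_cancel_left] at h2 h3
  refine (SimpleGraph.edist_triangle (v := k⁻¹ * q g)).trans ((add_le_add h2
    (SimpleGraph.edist_triangle (v := k⁻¹ * q x))).trans ((add_le_add le_rfl
      (add_le_add h1 h3)).trans ?_))
  exact_mod_cast (by gcongr : c * N + (L * p.length + c * N) ≤ c * N + (L * n + c * N))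

end ConedOff

theorem corollaryB {G H : Type*} [Group G] [Group H]
    (S₀ : Set G) (hS₀_finite : S₀.Finite) (hS₀ : Subgroup.closure S₀ = ⊤)
    (T₀ : Set H) (hT₀_finite : T₀.Finite) (hT₀ : Subgroup.closure T₀ = ⊤)
    (T : Set H) (hT : Subgroup.closure T = ⊤)
    (Qs : Set (Subgroup H)) (hQs : HyperbolicallyEmbedded Qs T)
    (q : G → H)
    (hq : IsQuasiIsometry (SimpleGraph.mulCayley S₀) (SimpleGraph.mulCayley T₀) q)
    (hQs_char : IsQICharacteristic T₀ Qs)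
    (S : Set G) (hS : Subgroup.closure S = ⊤)
    (hqS : IsQuasiIsometry (SimpleGraph.mulCayley S) (SimpleGraph.mulCayley T) q) :
    ∃ Ps : Set (Subgroup G), Ps.Finite ∧ HyperbolicallyEmbedded Ps S ∧
      IsGroupPairQuasiIsometry S₀ T₀ Ps Qs q := by
  obtain ⟨K, hqK⟩ := hq.exists_isNatQuasiIsometry
  obtain ⟨K', hqK'⟩ := hqS.exists_isNatQuasiIsometry
  obtain ⟨Ps, hPs, ⟨N, hPQ, hQP⟩, hsep⟩ :=
    exists_subgroups_of_isQICharacteristic hS₀ hT₀_finite hT₀ hQs_char hqK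
  refine ⟨Ps, hPs, ⟨closure_union_eq_top hS _, ?_, fun P hP g hg n => ?_⟩, ?_⟩
  · exact isHyperbolicGraph_conedOff hS₀_finite hS₀ hT₀_finite hT₀ hS hT hqK hqK' hPQ hQP hQs.2.1
  · exact finite_relativeGraph_ball hS₀_finite hS₀ hT₀_finite hT₀ hT hqK hqK' hPQ hsep
      hQs.2.2 hP hg n
  · obtain ⟨L, C, hLC⟩ := hq
    refine ⟨L, C, N + 1, by positivity, hLC, fun A hA => ?_, fun B hB => ?_⟩
    · obtain ⟨B, hB, h⟩ := hPQ A hA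
      exact ⟨B, hB, h.hausdorffDistLT⟩
    · obtain ⟨A, hA, h⟩ := hQP B hB
      exact ⟨A, hA, h.hausdorffDistLT⟩
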